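/- Let $(G,\mathfrak g)$ be a Banach--Lie supergroup: $G$ is a (real analytic) Banach--Lie group, $\mathfrak g=\mathfrak g_{\bar 0}\oplus\mathfrak g_{\bar 1}$ is a real Banach--Lie superalgebra (a Banach space with closed homogeneous parts and $\|[x,y]\|\le\|x\|\,\|y\|$), $\mathfrak g_{\bar 0}=\mathrm{Lie}(G)$, and $\mathrm{Ad}:G\to\mathrm{Aut}(\mathfrak g)$ is a morphism of Banach--Lie groups into the continuous even automorphisms of $\mathfrak g$ with $\mathsf d_e\mathrm{Ad}(x)=\mathrm{ad}_x$ for $x\in\mathfrak g_{\bar 0}$. For a unitary representation $\pi$ of $G$ on a Hilbert space $\mathscr H$ (continuous orbit maps) and $x\in\mathfrak g_{\bar 0}$ let $\mathsf d\pi(x)$ be the skew-adjoint generator of $t\mapsto\pi(\exp(tx))$, and let $\mathscr H^\infty$ be the space of all $v\in\mathscr H$ whose orbit map $g\mapsto\pi(g)v$ is smooth, with the topology given by the seminorms $$q_n(v)=\sup\{\|\mathsf d\pi(x_1)\cdots\mathsf d\pi(x_n)v\| : x_i\in\mathfrak g_{\bar 0},\ \|x_i\|\le 1\},\qquad n\ge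 0 .$$ Let $(\pi,\mathscr H,\mathscr B,\rho^{\mathscr B})$ be a pre-representation of $(G,\mathfrak g)$, that is: (i) $\pi$ is a unitary representation of $G$ by even operators on the $\mathbb Z_2$-graded complex Hilbert space $\mathscr H$; (ii) $\mathscr B$ is a dense $\mathbb Z_2$-graded subspace of $\mathscr H$ contained in $\mathcal D(\mathsf d\pi(x))$ for every $x\in\mathfrak g_{\bar 0}$; (iii) $\rho^{\mathscr B}:\mathfrak g\to\mathrm{End}_{\mathbb C}(\mathscr B)$ is a representation of the Lie superalgebra $\mathfrak g$; (iv) for $x\in\mathfrak g_{\bar 0}$, $\rho^{\mathscr B}(x)=\mathsf d\pi(x)|_{\mathscr B}$ is essentially skew-adjoint; (v) for $x\in\mathfrak g_{\bar 1}$, $e^{-\pi i/4}\rho^{\mathscr B}(x)$ is symmetric; (vi) every coset of the identity component $G^\circ$ in $G$ contains some $g$ with $\pi(g)^{-1}\mathscr B\subseteq\mathscr B$ and $\pi(g)\rho^{\mathscr B}(x)\pi(g)^{-1}=\rho^{\mathscr B}(\mathrm{Ad}(g)x)$ on $\mathscr B$ for all $x\in\mathfrak g_{\bar 1}$. For $x=(a_0+ib_0)+(a_1+ib_1)\in\mathfrak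 g^{\mathbb C}=\mathfrak g\otimes_{\mathbb R}\mathbb C$ with $a_j,b_j\in\mathfrak g_{\bar j}$ and $v\in\mathscr H^\infty$ put $$\tilde\rho(x)v=\overline{\rho^{\mathscr B}(a_0)}v+i\,\overline{\rho^{\mathscr B}(b_0)}v+\overline{\rho^{\mathscr B}(a_1)}v+i\,\overline{\rho^{\mathscr B}(b_1)}v .$$ Here $\mathfrak g^{\mathbb C}$ carries the complex bilinear extension of the bracket and the norm $\|z\|=\inf\{\sum_k|\zeta_k|\,\|v_k\| : z=\sum_k v_k\otimes\zeta_k\}$. Then $\tilde\rho(x)v$ is defined and lies in $\mathscr H^\infty$ for all $x\in\mathfrak g^{\mathbb C}$, $v\in\mathscr H^\infty$, and the following hold. (i) The map $\mathfrak g^{\mathbb C}\times\mathscr H^\infty\to\mathscr H^\infty$, $(x,v)\mapsto\tilde\rho(x)v$, is $\mathbb C$-bilinear. (ii) If $x,y\in\mathfrak g^{\mathbb C}$ are homogeneous of parities $p(x),p(y)$, then for all $v\in\mathscr H^\infty$ $$\tilde\rho([x,y])v=\tilde\rho(x)\tilde\rho(y)v-(-1)^{p(x)p(y)}\tilde\rho(y)\tilde\rho(x)v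 .$$ (iii) The map in (i) is (jointly) continuous. Moreover, every $q_n$ is finite on $\mathscr H^\infty$, and for all $y\in\mathfrak g_{\bar 1}$, $v\in\mathscr H^\infty$ and $n\ge 0$ $$q_n(\tilde\rho(y)v)\le\frac{1}{2\sqrt 2}\,\|y\|\sum_{k=0}^{n+1}\binom{n+1}{k}q_k(v).$$ -/

import Mathlib

open scoped Manifold ContDiff TensorProduct ENNReal Topology InnerProductSpace

noncomputable section

/-- The topology generated by the balls `{y | p i (y - x) < ε}`, `ε > 0`, of a family of
(semi)norms `p i`.  The values are taken in `[0, ∞]`, so that no finiteness has to be known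
beforehand. -/
abbrev gaugeTopology {X ι : Type*} [AddGroup X] (p : ι → X → ℝ≥0∞) : TopologicalSpace X :=
  TopologicalSpace.generateFrom
    {U | ∃ (i : ι) (x : X) (ε : ℝ≥0∞), 0 < ε ∧ U = {y | p i (y - x) < ε}}

/-! ### Complexification of a real Banach space -/

section Complexification

variable {V : Type*} [NormedAddCommGroup V] [NormedSpace ℝ V]

/-- The norm of the complexification: the infimum of `∑ |ζ_i| ‖x_i‖` over all representations
`z = ∑ ζ_i ⊗ x_i`. -/
def complexificationNorm (z : ℂ ⊗[ℝ] V) : ℝ≥0∞ :=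
  ⨅ (k : ℕ) (ζ : Fin k → ℂ) (x : Fin k → V) (_ : z = ∑ i, ζ i ⊗ₜ[ℝ] x i),
    ∑ i, ‖ζ i‖ₑ * ‖x i‖ₑ

/-- The norm topology of the complexification. -/
abbrev complexificationTopology (V : Type*) [NormedAddCommGroup V] [NormedSpace ℝ V] :
    TopologicalSpace (ℂ ⊗[ℝ] V) :=
  gaugeTopology fun _ : Unit => complexificationNorm

/-- The real part: `a` if `z = 1 ⊗ a + i ⊗ b`. -/
def tensorRe : ℂ ⊗[ℝ] V →ₗ[ℝ] V :=
  (TensorProduct.lid ℝ V).toLinearMap ∘ₗ Complex.reLm.rTensor V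

/-- The imaginary part: `b` if `z = 1 ⊗ a + i ⊗ b`. -/
def tensorIm : ℂ ⊗[ℝ] V →ₗ[ℝ] V :=
  (TensorProduct.lid ℝ V).toLinearMap ∘ₗ Complex.imLm.rTensor V

end Complexification

/-! ### Banach--Lie superalgebras and Banach--Lie supergroups -/

/-- The structure of a real Banach--Lie superalgebra on a (complete) normed space `𝔤`. -/
structure BanachLieSuperalgebra (𝔤 : Type*) [NormedAddCommGroup 𝔤] [NormedSpace ℝ 𝔤] where
  /-- the homogeneous parts `𝔤₀` and `𝔤₁` -/
  part : ZMod 2 → Submodule ℝ 𝔤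
  isCompl : IsCompl (part 0) (part 1)
  isClosed_part : ∀ i, IsClosed (part i : Set 𝔤)
  /-- the superbracket -/
  bracket : 𝔤 →ₗ[ℝ] 𝔤 →ₗ[ℝ] 𝔤
  bracket_mem : ∀ i j : ZMod 2, ∀ x ∈ part i, ∀ y ∈ part j, bracket x y ∈ part (i + j)
  bracket_skew : ∀ i j : ZMod 2, ∀ x ∈ part i, ∀ y ∈ part j,
    bracket x y = -((-1 : ℝ) ^ (i.val * j.val) • bracket y x)
  jacobi : ∀ i j : ZMod 2, ∀ x ∈ part i, ∀ y ∈ part j, ∀ z,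
    bracket x (bracket y z) =
      bracket (bracket x y) z + (-1 : ℝ) ^ (i.val * j.val) • bracket y (bracket x z)
  norm_bracket_le : ∀ x y, ‖bracket x y‖ ≤ ‖x‖ * ‖y‖

namespace BanachLieSuperalgebra

variable {𝔤 : Type*} [NormedAddCommGroup 𝔤] [NormedSpace ℝ 𝔤] (S : BanachLieSuperalgebra 𝔤)

/-- The even component of an element, as an element of `𝔤₀`. -/
def evenPart : 𝔤 →ₗ[ℝ] S.part 0 := (S.part 0).projectionOnto (S.part 1) S.isCompl

/-- The odd component of an element, as an element of `𝔤₁`. -/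
def oddPart : 𝔤 →ₗ[ℝ] S.part 1 := (S.part 1).projectionOnto (S.part 0) S.isCompl.symm

/-- The superbracket of the complexification `ℂ ⊗ 𝔤`, the complex bilinear extension of the
superbracket of `𝔤`. -/
def bracketC : (ℂ ⊗[ℝ] 𝔤) →ₗ[ℂ] (ℂ ⊗[ℝ] 𝔤) →ₗ[ℂ] (ℂ ⊗[ℝ] 𝔤) :=
  LinearMap.BilinMap.baseChange ℂ S.bracket

/-- The homogeneous parts of the complexification. -/
def partC (i : ZMod 2) : Submodule ℂ (ℂ ⊗[ℝ] 𝔤) := (S.part i).baseChange ℂ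

end BanachLieSuperalgebra

/-- A Banach--Lie supergroup `(G, 𝔤)`; the Banach--Lie group `G` is modelled on `E`. -/
structure BanachLieSupergroup (E G 𝔤 : Type*) [NormedAddCommGroup E] [NormedSpace ℝ E]
    [TopologicalSpace G] [ChartedSpace E G] [Group G] [LieGroup 𝓘(ℝ, E) ω G]
    [NormedAddCommGroup 𝔤] [NormedSpace ℝ 𝔤] extends BanachLieSuperalgebra 𝔤 where
  /-- the identification of `𝔤₀` with the Lie algebra of `G` -/
  lieIso : part 0 ≃L[ℝ] GroupLieAlgebra 𝓘(ℝ, E) G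
  lieIso_bracket : ∀ x y z : part 0, (z : 𝔤) = bracket x y → lieIso z = ⁅lieIso x, lieIso y⁆
  /-- the adjoint action of `G` on `𝔤` -/
  Ad : G →* (𝔤 ≃L[ℝ] 𝔤)
  Ad_even : ∀ g i, ∀ x ∈ part i, Ad g x ∈ part i
  Ad_bracket : ∀ g x y, Ad g (bracket x y) = bracket (Ad g x) (Ad g y)
  Ad_analytic :
    ContMDiff 𝓘(ℝ, E) 𝓘(ℝ, 𝔤 →L[ℝ] 𝔤) ω (fun g : G => (Ad g : 𝔤 →L[ℝ] 𝔤))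
  Ad_deriv : ∀ (x : part 0) (y : 𝔤),
    (show 𝔤 →L[ℝ] 𝔤 from
      mfderiv 𝓘(ℝ, E) 𝓘(ℝ, 𝔤 →L[ℝ] 𝔤) (fun g : G => (Ad g : 𝔤 →L[ℝ] 𝔤)) 1 (lieIso x)) y
      = bracket x y

/-! ### The exponential map -/

section Exponential

variable {E G : Type*} [NormedAddCommGroup E] [NormedSpace ℝ E]
  [TopologicalSpace G] [ChartedSpace E G] [Group G]

open Classical in
/-- The one-parameter subgroup `t ↦ exp (t x)` of a Banach--Lie group `G`, i.e. the integral curve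
through `1` of the left invariant vector field of `x` (it exists and is unique if `E` is
complete). -/
def expCurve (x : GroupLieAlgebra 𝓘(ℝ, E) G) : ℝ → G :=
  if h : ∃ γ : ℝ → G, γ 0 = 1 ∧
      IsMIntegralCurve (I := 𝓘(ℝ, E)) γ (mulInvariantVectorField x) then h.choose
  else fun _ => 1

end Exponential

/-! ### Unbounded operators -/

section Operators

variable {H : Type*} [NormedAddCommGroup H] [InnerProductSpace ℂ H]

/-- The infinitesimal generator `v ↦ d/dt|_{t = 0} U(t) v` of a family of unitary operators; its
domain consists of all `v` for which the derivative exists.  For a strongly continuous one-parameter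
group this is the skew-adjoint operator given by Stone's theorem. -/
def infinitesimalGenerator (U : ℝ → (H ≃ₗᵢ[ℂ] H)) : H →ₗ.[ℂ] H where
  domain :=
    { carrier := {v | DifferentiableAt ℝ (fun t => U t v) 0}
      add_mem' := by
        intro a b ha hb
        have h := DifferentiableAt.add ha hb
        simpa [Pi.add_def] using h
      zero_mem' := by simp
      smul_mem' := by
        intro c a ha
        have h := DifferentiableAt.const_smul ha c
        simpa [Pi.smul_def] using h }
  toFun :=
    { toFun := fun v => deriv (fun t => U t (v : H)) 0
      map_add' := by
        rintro ⟨a, ha⟩ ⟨b, hb⟩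
        have h := deriv_add (𝕜 := ℝ) ha hb
        simpa [Pi.add_def] using h
      map_smul' := by
        rintro c ⟨a, ha⟩
        have h := deriv_const_smul (𝕜 := ℝ) c ha
        simpa [Pi.smul_def] using h }

/-- A densely defined operator is essentially skew-adjoint if it is closable and its closure is
skew-adjoint. -/
def IsEssentiallySkewAdjoint [CompleteSpace H] (A : H →ₗ.[ℂ] H) : Prop :=
  A.IsClosable ∧ A.closure.adjoint = -A.closure

/-- An endomorphism of a subspace of `H` as an unbounded operator on `H`. -/
def endToPMap {B : Submodule ℂ H} (T : B →ₗ[ℂ] B) : H →ₗ.[ℂ] H := ⟨B, B.subtype ∘ₗ T⟩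

end Operators

/-! ### Unitary representations and smooth vectors -/

/-- A unitary representation of a topological group, with continuous orbit maps. -/
structure UnitaryRep (G H : Type*) [TopologicalSpace G] [Group G]
    [NormedAddCommGroup H] [InnerProductSpace ℂ H] where
  /-- the homomorphism to the unitary group -/
  toHom : G →* (H ≃ₗᵢ[ℂ] H)
  continuous_orbit : ∀ v : H, Continuous fun g => toHom g v

namespace UnitaryRep

section Smooth

variable {G H : Type*} [TopologicalSpace G] [Group G]
  [NormedAddCommGroup H] [InnerProductSpace ℂ H] (π : UnitaryRep G H)

/-- The operator `dπ(x)`: the generator of `t ↦ π (exp (t x))`. -/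
def dOp {E : Type*} [NormedAddCommGroup E] [NormedSpace ℝ E] [ChartedSpace E G]
    (x : GroupLieAlgebra 𝓘(ℝ, E) G) : H →ₗ.[ℂ] H :=
  infinitesimalGenerator fun t => π.toHom (expCurve x t)

/-- The subspace `H^∞` of smooth vectors. -/
def smoothVectors (E : Type*) [NormedAddCommGroup E] [NormedSpace ℝ E] [ChartedSpace E G] :
    Submodule ℂ H where
  carrier := {v | ContMDiff 𝓘(ℝ, E) 𝓘(ℝ, H) ∞ (fun g : G => π.toHom g v)}
  add_mem' := by
    intro a b ha hb
    have h := ContMDiff.add ha hb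
    simpa [Pi.add_def] using h
  zero_mem' := by
    simpa using (contMDiff_const : ContMDiff 𝓘(ℝ, E) 𝓘(ℝ, H) ∞ (fun _ : G => (0 : H)))
  smul_mem' := by
    intro c a ha
    have h := ((c • ContinuousLinearMap.id ℝ H).contMDiff (n := ∞)).comp ha
    simpa [Function.comp_def] using h

end Smooth

section Seminorms

variable {E G 𝔤 H : Type*} [NormedAddCommGroup E] [NormedSpace ℝ E]
  [TopologicalSpace G] [ChartedSpace E G] [Group G] [LieGroup 𝓘(ℝ, E) ω G]
  [NormedAddCommGroup 𝔤] [NormedSpace ℝ 𝔤]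
  [NormedAddCommGroup H] [InnerProductSpace ℂ H]
  (S : BanachLieSupergroup E G 𝔤) (π : UnitaryRep G H)

/-- `IteratedEq S π [x₁, …, xₙ] v w` says that `v` lies in the domain of the product of unbounded
operators `dπ(x₁) ⋯ dπ(xₙ)` and that `dπ(x₁) ⋯ dπ(xₙ) v = w`. -/
def IteratedEq : List (S.part 0) → H → H → Prop
  | [], v, w => v = w
  | x :: xs, v, w => ∃ u, IteratedEq xs v u ∧ (u, w) ∈ (π.dOp (S.lieIso x)).graph

/-- The seminorm `q_n(v) = sup {‖dπ(x₁) ⋯ dπ(xₙ) v‖ : xᵢ ∈ 𝔤₀, ‖xᵢ‖ ≤ 1}`. -/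
def q (n : ℕ) (v : H) : ℝ≥0∞ :=
  ⨆ (xs : List (S.part 0)) (w : H) (_ : xs.length = n) (_ : ∀ x ∈ xs, ‖x‖ ≤ 1)
    (_ : IteratedEq S π xs v w), ‖w‖ₑ

/-- The topology of `H^∞`, given by the seminorms `q_n`. -/
abbrev smoothTopology : TopologicalSpace (π.smoothVectors E) :=
  gaugeTopology fun (n : ℕ) (v : π.smoothVectors E) => π.q S n v

end Seminorms

end UnitaryRep

/-! ### Pre-representations -/

/-- A `ℤ/2`-grading of a Hilbert space: an orthogonal sum of two closed subspaces. -/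
structure HilbertGrading (H : Type*) [NormedAddCommGroup H] [InnerProductSpace ℂ H] where
  /-- the homogeneous parts `H₀` and `H₁` -/
  part : ZMod 2 → Submodule ℂ H
  isClosed_part : ∀ i, IsClosed (part i : Set H)
  orthogonal : part 0 ⟂ part 1
  isCompl : IsCompl (part 0) (part 1)

/-- A pre-representation `(π, H, 𝓑, ρ)` of a Banach--Lie supergroup `(G, 𝔤)` on a Hilbert
space `H`. -/
structure PreRepresentation {E G 𝔤 : Type*} [NormedAddCommGroup E] [NormedSpace ℝ E]
    [TopologicalSpace G] [ChartedSpace E G] [Group G] [LieGroup 𝓘(ℝ, E) ω G]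
    [NormedAddCommGroup 𝔤] [NormedSpace ℝ 𝔤] (S : BanachLieSupergroup E G 𝔤)
    (H : Type*) [NormedAddCommGroup H] [InnerProductSpace ℂ H] [CompleteSpace H] where
  /-- the grading of `H` -/
  grading : HilbertGrading H
  /-- the unitary representation of `G` on `H` -/
  π : UnitaryRep G H
  π_even : ∀ g i, ∀ v ∈ grading.part i, π.toHom g v ∈ grading.part i
  /-- the dense domain -/
  B : Submodule ℂ H
  dense_B : Dense (B : Set H)
  graded_B : B ≤ (B ⊓ grading.part 0) ⊔ (B ⊓ grading.part 1)
  B_le_domain : ∀ x : S.part 0, B ≤ (π.dOp (S.lieIso x)).domain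
  /-- the representation of the Lie superalgebra on `B` -/
  ρ : 𝔤 →ₗ[ℝ] (B →ₗ[ℂ] B)
  ρ_parity : ∀ i j, ∀ x ∈ S.part i, ∀ v : B, (v : H) ∈ grading.part j →
    (ρ x v : H) ∈ grading.part (i + j)
  ρ_bracket : ∀ i j, ∀ x ∈ S.part i, ∀ y ∈ S.part j, ∀ v,
    ρ (S.bracket x y) v = ρ x (ρ y v) - (-1 : ℂ) ^ (i.val * j.val) • ρ y (ρ x v)
  ρ_even : ∀ (x : S.part 0) (v : B), ((v : H), (ρ x v : H)) ∈ (π.dOp (S.lieIso x)).graph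
  ρ_even_skew : ∀ x : S.part 0, IsEssentiallySkewAdjoint (endToPMap (ρ x))
  ρ_odd_symm : ∀ x : S.part 1,
    (Complex.exp (-(Real.pi * Complex.I / 4)) • ρ x).IsSymmetric
  /-- every coset of the identity component contains an element `g` with `π(g)⁻¹ B ⊆ B` and
  `π(g) ρ(x) π(g)⁻¹ = ρ(Ad(g) x)` on `B` for all odd `x` -/
  conj : ∀ h : G, ∃ g : G, h⁻¹ * g ∈ connectedComponent (1 : G) ∧
    ∃ hB : ∀ v : B, (π.toHom g).symm (v : H) ∈ B, ∀ (x : S.part 1) (v : B),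
      π.toHom g (ρ x ⟨(π.toHom g).symm v, hB v⟩ : H) = ρ (S.Ad g x) v

namespace PreRepresentation

variable {E G 𝔤 H : Type*} [NormedAddCommGroup E] [NormedSpace ℝ E]
  [TopologicalSpace G] [ChartedSpace E G] [Group G] [LieGroup 𝓘(ℝ, E) ω G]
  [NormedAddCommGroup 𝔤] [NormedSpace ℝ 𝔤]
  [NormedAddCommGroup H] [InnerProductSpace ℂ H] [CompleteSpace H]
  {S : BanachLieSupergroup E G 𝔤} (R : PreRepresentation S H)

/-- The space `H^∞` of smooth vectors of `π`. -/
abbrev Hinf : Submodule ℂ H := R.π.smoothVectors E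

/-- The closure of the operator `ρ(x)` with domain `B`. -/
def closedOp (x : 𝔤) : H →ₗ.[ℂ] H := (endToPMap (R.ρ x)).closure

/-- The operator `ρ̃(x)`, `x ∈ 𝔤^ℂ`: the sum
`closure ρ(a₀) + i closure ρ(b₀) + closure ρ(a₁) + i closure ρ(b₁)` of unbounded operators,
restricted to `H^∞`, where `x = (a₀ + i b₀) + (a₁ + i b₁)` with `aⱼ, bⱼ ∈ 𝔤ⱼ`. -/
def tilde (x : ℂ ⊗[ℝ] 𝔤) : H →ₗ.[ℂ] H :=
  (R.closedOp (S.evenPart (tensorRe x)) + Complex.I • R.closedOp (S.evenPart (tensorIm x)) +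
    R.closedOp (S.oddPart (tensorRe x)) + Complex.I • R.closedOp (S.oddPart (tensorIm x))).domRestrict
      R.Hinf

end PreRepresentation

end

noncomputable section

/-! ### Smoothness of maps into a closed subspace -/

section CodRestrict

/-! The main point is that the closure of `ρ(y)`, `y` odd, maps smooth vectors to smooth vectors. On
`B` one has `ρ([y,y]) = 2ρ(y)²`, and symmetry up to a phase gives `‖ρ(y)b‖² ≤ ½‖b‖‖ρ([y,y])b‖`.
Hence a vector in the domain of the closure of `ρ([y,y])` lies in the domain of the closure of
`ρ(y)`. Essential skew-adjointness puts `dπ(x)` inside the closure of `ρ(x)`, so every smooth vector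
qualifies. The odd operator thus becomes a continuous bilinear map `oddJet` on `𝔤₁ × jetSpace`,
where `jetSpace` is a Banach space of pairs `(v, x ↦ dπ(x)v)`.

Smoothness follows from the covariance `π(g)ρ(y)v = ρ(Ad(g)y)π(g)v`: its right side is `oddJet`
applied to two smooth functions of `g`. Along a one-parameter group, covariance holds because the
pairing of the right side with `π(exp tx)b`, `b ∈ B`, has derivative zero; this is the even-odd
commutation relation in weak form. The covariant elements form a closed subgroup, and a closed
subgroup with all one-parameter groups contains the identity component. That last fact comes from
Ekeland's principle: a closed set with curves of every velocity through each of its points is open.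
Condition (vi) reaches the remaining components.

The bracket relations are tested against `B`, where adjunction reduces them to those of `ρ`. For the
estimates, `n = 0` is the quadratic inequality above with the arithmetic-geometric mean inequality,
and the induction step commutes `dπ(x)` past `ρ(y)` and uses Pascal's rule. Finiteness of `q_n`
comes from the closed graph theorem and uniform boundedness. Joint continuity follows from the
bilinear bounds on the seminorms. -/

theorem LinearIsometry.exists_hasFDerivAt {E K F : Type*} [NormedAddCommGroup E] [NormedSpace ℝ E]
    [NormedAddCommGroup K] [NormedSpace ℝ K] [CompleteSpace K]
    [NormedAddCommGroup F] [NormedSpace ℝ F] (j : K →ₗᵢ[ℝ] F) {h : E → K} {A : E →L[ℝ] F} {x : E}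
    (hA : HasFDerivAt (fun y => j (h y)) A x) :
    ∃ A' : E →L[ℝ] K, HasFDerivAt h A' x ∧ A = j.toContinuousLinearMap ∘L A' := by
  have hcl : IsClosed (Set.range j) := j.isometry.isClosedEmbedding.isClosed_range
  -- The difference quotients lie in the range of `j`, which is closed because `K` is complete, so
  -- their limit `A v` does too.
  have hmem : ∀ v, A v ∈ LinearMap.range j.toLinearMap := by
    intro v
    have h1 : HasDerivAt (fun t : ℝ => j (h (x + t • v))) (A v) 0 := by
      have h2 : HasDerivAt (fun t : ℝ => x + t • v) v 0 := by
        simpa using ((hasDerivAt_id (0 : ℝ)).smul_const v).const_add x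
      have h3 : HasFDerivAt (fun y => j (h y)) A (x + (0 : ℝ) • v) := by simpa using hA
      exact h3.comp_hasDerivAt (0 : ℝ) h2
    have h4 := h1.tendsto_slope_zero
    have : A v ∈ Set.range j := by
      refine hcl.mem_of_tendsto h4 (Filter.Eventually.of_forall fun t => ?_)
      refine ⟨t⁻¹ • (h (x + (0 + t) • v) - h (x + (0 : ℝ) • v)), ?_⟩
      simp
    obtain ⟨k, hk⟩ := this
    exact ⟨k, hk⟩
  let A' : E →L[ℝ] K :=
    (j.equivRange.symm.toContinuousLinearEquiv : _ →L[ℝ] K) ∘L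
      A.codRestrict (LinearMap.range j.toLinearMap) hmem
  have hA' : A = j.toContinuousLinearMap ∘L A' := by
    ext v
    have := j.equivRange.apply_symm_apply (A.codRestrict (LinearMap.range j.toLinearMap) hmem v)
    exact (congrArg Subtype.val this).symm
  refine ⟨A', ?_, hA'⟩
  rw [hasFDerivAt_iff_isLittleO] at hA ⊢
  refine (Asymptotics.isLittleO_norm_left.1 ?_)
  refine (Asymptotics.isLittleO_norm_left.2 hA).congr_left fun y => ?_
  rw [hA', ← j.norm_map]
  simp

universe u v w

/-- Induction on the order: postcomposition with `j` is again a linear isometry, from `E →L[ℝ] K` to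
`E →L[ℝ] F`, and the hypothesis is applied to it. Hence `K` and `F` vary in the induction, in a
universe closed under forming maps out of `E`. -/
theorem LinearIsometry.contDiffOn_nat {E : Type u} [NormedAddCommGroup E] [NormedSpace ℝ E]
    {s : Set E} (hs : IsOpen s) (n : ℕ) :
    ∀ {K F : Type (max u v)} [NormedAddCommGroup K] [NormedSpace ℝ K] [CompleteSpace K]
      [NormedAddCommGroup F] [NormedSpace ℝ F] (j : K →ₗᵢ[ℝ] F) {h : E → K},
      ContDiffOn ℝ n (fun y => j (h y)) s → ContDiffOn ℝ n h s := by
  induction n with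
  | zero =>
    intro K F _ _ _ _ _ j h hh
    simp only [Nat.cast_zero, contDiffOn_zero] at hh ⊢
    exact (j.isometry.isEmbedding.isInducing.continuousOn_iff).2 hh
  | succ n ih =>
    intro K F _ _ _ _ _ j h hh
    rw [Nat.cast_succ, contDiffOn_succ_iff_fderiv_of_isOpen hs] at hh ⊢
    obtain ⟨hd, -, hf⟩ := hh
    have hd' : ∀ x ∈ s, ∃ A' : E →L[ℝ] K, HasFDerivAt h A' x ∧
        fderiv ℝ (fun y => j (h y)) x = j.toContinuousLinearMap ∘L A' := fun x hx =>
      j.exists_hasFDerivAt ((hd x hx).differentiableAt (hs.mem_nhds hx)).hasFDerivAt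
    refine ⟨fun x hx => ?_, fun hn => absurd hn (by simp), ?_⟩
    · obtain ⟨A', h1, -⟩ := hd' x hx
      exact h1.differentiableAt.differentiableWithinAt
    · refine ih (LinearIsometry.postcomp (σ₁₂ := RingHom.id ℝ) (E := E) j) (hf.congr fun x hx => ?_)
      obtain ⟨A', h1, h2⟩ := hd' x hx
      rw [h2, h1.fderiv]
      rfl

theorem LinearIsometry.contDiffOn {E : Type u} [NormedAddCommGroup E] [NormedSpace ℝ E]
    {s : Set E} (hs : IsOpen s) {K : Type v} {F : Type w} [NormedAddCommGroup K] [NormedSpace ℝ K]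
    [CompleteSpace K] [NormedAddCommGroup F] [NormedSpace ℝ F] (j : K →ₗᵢ[ℝ] F) {h : E → K}
    (hh : ContDiffOn ℝ ∞ (fun y => j (h y)) s) : ContDiffOn ℝ ∞ h s := by
  rw [contDiffOn_infty] at hh ⊢
  intro n
  -- Lifting puts `K` and `F` in one universe that contains that of `E`.
  let eE : ULift.{max u w} K ≃ₗᵢ[ℝ] K := LinearIsometryEquiv.ulift ℝ K
  let eF : ULift.{max u v} F ≃ₗᵢ[ℝ] F := LinearIsometryEquiv.ulift ℝ F
  have := LinearIsometry.contDiffOn_nat.{u, max v w} hs n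
    (eF.symm.toLinearIsometry.comp (j.comp eE.toLinearIsometry)) (h := fun y => eE.symm (h y)) ?_
  · exact eE.toContinuousLinearEquiv.toContinuousLinearMap.contDiff.comp_contDiffOn this
  · exact eF.symm.toContinuousLinearEquiv.toContinuousLinearMap.contDiff.comp_contDiffOn (hh n)

theorem ContMDiff.of_linearIsometry_comp {E G K F : Type*} [NormedAddCommGroup E] [NormedSpace ℝ E]
    [TopologicalSpace G] [ChartedSpace E G] [IsManifold 𝓘(ℝ, E) ∞ G]
    [NormedAddCommGroup K] [NormedSpace ℝ K] [CompleteSpace K]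
    [NormedAddCommGroup F] [NormedSpace ℝ F] (j : K →ₗᵢ[ℝ] F) {h : G → K}
    (hh : ContMDiff 𝓘(ℝ, E) 𝓘(ℝ, F) ∞ (fun g => j (h g))) : ContMDiff 𝓘(ℝ, E) 𝓘(ℝ, K) ∞ h := by
  rw [contMDiff_iff] at hh ⊢
  refine ⟨(j.isometry.isEmbedding.isInducing.continuous_iff).2 hh.1, fun x y => ?_⟩
  have := hh.2 x (j y)
  rw [extChartAt_model_space_eq_id] at this ⊢
  simp only [mfld_simps] at this ⊢
  exact j.contDiffOn (h := h ∘ (chartAt E x).symm) (chartAt E x).open_target this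

end CodRestrict

/-! ### Closed sets which are tangent to every direction -/

section Tangent

/-- Ekeland's variational principle. -/
theorem exists_strict_min_add_dist {X : Type*} [MetricSpace X] [CompleteSpace X] {f : X → ℝ}
    (hf : Continuous f) (hf0 : ∀ x, 0 ≤ f x) {ε : ℝ} (hε : 0 < ε) (x₀ : X) :
    ∃ p, f p + ε * dist x₀ p ≤ f x₀ ∧ ∀ q, f q + ε * dist p q ≤ f p → q = p := by
  -- Membership `q ∈ S p` is a preorder. Descending along near-minimisers of `f` on these sets gives
  -- a Cauchy sequence, and its limit is a minimal element.
  let S : X → Set X := fun p => {q | f q + ε * dist p q ≤ f p}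
  have hS_self : ∀ p, p ∈ S p := fun p => by simp [S]
  have hS_trans : ∀ {p q r}, q ∈ S p → r ∈ S q → r ∈ S p := by
    intro p q r hq hr
    simp only [S, Set.mem_ofPred_eq] at *
    nlinarith [dist_triangle p q r]
  have hbdd : ∀ p, BddBelow (f '' S p) := fun p => ⟨0, by rintro _ ⟨q, -, rfl⟩; exact hf0 q⟩
  have hstep : ∀ (n : ℕ) (p : X), ∃ q ∈ S p, ∀ r ∈ S p, f q ≤ f r + (1 / 2) ^ n := by
    intro n p
    obtain ⟨_, ⟨q, hq, rfl⟩, hlt⟩ := exists_lt_of_csInf_lt (s := f '' S p)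
      ⟨_, Set.mem_image_of_mem f (hS_self p)⟩
      (lt_add_of_pos_right (sInf (f '' S p)) (show (0 : ℝ) < (1 / 2) ^ n by positivity))
    refine ⟨q, hq, fun r hr => ?_⟩
    have := csInf_le (hbdd p) (Set.mem_image_of_mem f hr)
    linarith
  choose nxt hnxt hmin using hstep
  let s : ℕ → X := fun n => Nat.rec x₀ (fun n p => nxt n p) n
  have hs : ∀ n, s (n + 1) ∈ S (s n) := fun n => hnxt n _
  have hle : ∀ n m, n ≤ m → s m ∈ S (s n) := by
    intro n m hnm
    induction hnm with
    | refl => exact hS_self _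
    | step _ ih => exact hS_trans ih (hs _)
  have hanti : Antitone fun n => f (s n) := by
    intro n m hnm
    have := hle n m hnm
    simp only [S, Set.mem_ofPred_eq] at this
    have h2 : 0 ≤ ε * dist (s n) (s m) := by positivity
    simp only
    linarith
  have hconv := tendsto_atTop_ciInf hanti ⟨0, by rintro _ ⟨n, rfl⟩; exact hf0 _⟩
  have hcau : CauchySeq s := by
    rw [Metric.cauchySeq_iff']
    intro δ hδ
    have h1 := hconv.cauchySeq
    rw [Metric.cauchySeq_iff'] at h1
    obtain ⟨N, hN⟩ := h1 (ε * δ) (by positivity)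
    refine ⟨N, fun n hn => ?_⟩
    have h2 := hN n hn
    have h3 := hle N n hn
    simp only [S, Set.mem_ofPred_eq] at h3
    rw [Real.dist_eq] at h2
    have h4 := (abs_lt.1 h2).1
    rw [dist_comm]
    by_contra! hcon
    nlinarith
  obtain ⟨p, hp⟩ := cauchySeq_tendsto_of_complete hcau
  have hpS : ∀ n, p ∈ S (s n) := by
    intro n
    have hcl : IsClosed (S (s n)) := isClosed_le (by fun_prop) (by fun_prop)
    exact hcl.mem_of_tendsto hp (Filter.eventually_atTop.2 ⟨n, fun m hm => hle n m hm⟩)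
  refine ⟨p, hpS 0, fun q hq => ?_⟩
  have h5 : ∀ n, f p ≤ f q + (1 / 2) ^ n := by
    intro n
    have h6 := hmin n (s n) q (hS_trans (hpS n) hq)
    have h7 := hpS (n + 1)
    simp only [S, Set.mem_ofPred_eq] at h7
    have h8 : 0 ≤ ε * dist (s (n + 1)) p := by positivity
    have h9 : f (s (n + 1)) ≤ f q + (1 / 2) ^ n := h6
    linarith
  have h10 : f p ≤ f q := by
    refine ge_of_tendsto' (x := Filter.atTop) (f := fun n : ℕ => f q + (1 / 2 : ℝ) ^ n) ?_ h5
    simpa using (tendsto_pow_atTop_nhds_zero_of_lt_one (by norm_num : (0 : ℝ) ≤ 1 / 2)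
      (by norm_num)).const_add (f q)
  have h11 : dist p q ≤ 0 := by
    by_contra! hcon
    nlinarith
  exact (dist_le_zero.1 h11).symm

/-- A locally closed set through each point of which there are curves in the set with arbitrary
velocity is open. -/
theorem ball_subset_of_forall_hasDerivAt {E : Type*} [NormedAddCommGroup E] [NormedSpace ℝ E]
    [CompleteSpace E] {C : Set E} {p₀ : E} {R : ℝ} (hR : 0 < R) (hp₀ : p₀ ∈ C)
    (hC : IsClosed (C ∩ Metric.closedBall p₀ R))
    (htan : ∀ p ∈ C ∩ Metric.ball p₀ R, ∀ ξ : E, ∃ c : ℝ → E, c 0 = p ∧ HasDerivAt c ξ 0 ∧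
      ∀ᶠ t in 𝓝 (0 : ℝ), c t ∈ C) :
    Metric.ball p₀ (R / 2) ⊆ C := by
  intro z hz
  let X := {p : E // p ∈ C ∩ Metric.closedBall p₀ R}
  have : CompleteSpace X := hC.completeSpace_coe
  -- Ekeland's principle is applied to the distance from `z` with slope `1/2`. Since `‖z - p₀‖ < R /
  -- 2`, the minimiser stays in the open ball of radius `R`.
  obtain ⟨⟨p, hpC, hpR⟩, h1, h2⟩ := exists_strict_min_add_dist (X := X)
    (f := fun p => ‖z - p.1‖) (by fun_prop) (fun _ => norm_nonneg _)
    (show (0 : ℝ) < 1 / 2 by norm_num) ⟨p₀, hp₀, by simp [hR.le]⟩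
  change ‖z - p‖ + 1 / 2 * dist p₀ p ≤ ‖z - p₀‖ at h1
  have h2' : ∀ q ∈ C ∩ Metric.closedBall p₀ R, ‖z - q‖ + 1 / 2 * dist p q ≤ ‖z - p‖ → q = p :=
    fun q hq hle => congrArg Subtype.val (h2 ⟨q, hq⟩ hle)
  rw [Metric.mem_ball, dist_eq_norm] at hz
  have hpball : p ∈ Metric.ball p₀ R := by
    rw [Metric.mem_ball, dist_comm]
    linarith [norm_nonneg (z - p)]
  by_cases hzp : z = p
  · exact hzp ▸ hpC
  exfalso
  -- Moving from `p` towards `z` lowers the distance to `z` at full rate, while the penalty grows at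
  -- only half that rate, against minimality of `p`. The error `‖z - p‖ / 8` chosen below is small
  -- enough to keep this gap.
  obtain ⟨c, hc0, hc, hcC⟩ := htan p ⟨hpC, hpball⟩ (z - p)
  have hpos : 0 < ‖z - p‖ := norm_pos_iff.2 (sub_ne_zero.2 hzp)
  have hball : ∀ᶠ t in 𝓝 (0 : ℝ), c t ∈ Metric.ball p₀ R :=
    hc.continuousAt.eventually_mem (by rw [hc0]; exact Metric.isOpen_ball.mem_nhds hpball)
  have ho := (hasDerivAt_iff_isLittleO_nhds_zero.1 hc).def (show (0 : ℝ) < ‖z - p‖ / 8 by positivity)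
  have hev : ∀ᶠ t in 𝓝[>] (0 : ℝ), t < 1 ∧ 0 < t ∧ c t ∈ C ∧ c t ∈ Metric.ball p₀ R ∧
      ‖c (0 + t) - c 0 - t • (z - p)‖ ≤ ‖z - p‖ / 8 * ‖t‖ := by
    refine Filter.Eventually.and ?_ (Filter.Eventually.and self_mem_nhdsWithin ?_)
    · exact nhdsWithin_le_nhds (gt_mem_nhds (by norm_num : (0 : ℝ) < 1))
    · exact nhdsWithin_le_nhds (hcC.and (hball.and ho))
  obtain ⟨t, ht1, ht0, htC, htb, hto⟩ := hev.exists
  rw [zero_add, hc0, Real.norm_of_nonneg ht0.le] at hto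
  set r := c t - p - t • (z - p) with hr
  have e1 : ‖z - c t‖ ≤ (1 - t) * ‖z - p‖ + ‖r‖ := by
    have : z - c t = (1 - t) • (z - p) - r := by rw [hr]; module
    rw [this]
    refine (norm_sub_le _ _).trans ?_
    rw [norm_smul, Real.norm_of_nonneg (by linarith)]
  have e2 : ‖p - c t‖ ≤ t * ‖z - p‖ + ‖r‖ := by
    have : p - c t = -(t • (z - p) + r) := by rw [hr]; module
    rw [this, norm_neg]
    refine (norm_add_le _ _).trans ?_
    rw [norm_smul, Real.norm_of_nonneg ht0.le]
  have key := h2' (c t) ⟨htC, Metric.ball_subset_closedBall htb⟩ (by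
    rw [dist_eq_norm]
    nlinarith)
  have : ‖r‖ = t * ‖z - p‖ := by
    rw [hr, key, sub_self, zero_sub, norm_neg, norm_smul, Real.norm_of_nonneg ht0.le]
  nlinarith

end Tangent

/-! ### Generators and closures of unbounded operators -/

section Operators

variable {H : Type*} [NormedAddCommGroup H] [InnerProductSpace ℂ H]

theorem mem_graph_infinitesimalGenerator {U : ℝ → (H ≃ₗᵢ[ℂ] H)} {v w : H} :
    (v, w) ∈ (infinitesimalGenerator U).graph ↔ HasDerivAt (fun t => U t v) w 0 := by
  rw [LinearPMap.mem_graph_iff]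
  constructor
  · rintro ⟨⟨v', hv'⟩, h1, h2⟩
    simp only at h1 h2
    subst h1
    rw [← h2]
    exact DifferentiableAt.hasDerivAt hv'
  · intro h
    exact ⟨⟨v, h.differentiableAt⟩, rfl, h.deriv⟩

/-- The generator of a family of unitary operators is skew-symmetric. -/
theorem inner_infinitesimalGenerator {U : ℝ → (H ≃ₗᵢ[ℂ] H)} (hU : U 0 = 1) {v v' w w' : H}
    (hv : (v, v') ∈ (infinitesimalGenerator U).graph)
    (hw : (w, w') ∈ (infinitesimalGenerator U).graph) :
    ⟪v', w⟫_ℂ = -⟪v, w'⟫_ℂ := by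
  rw [mem_graph_infinitesimalGenerator] at hv hw
  have h1 := hv.inner ℂ hw
  simp only [LinearIsometryEquiv.inner_map_map, hU, LinearIsometryEquiv.coe_one, id] at h1
  have h2 := h1.unique (hasDerivAt_const 0 _)
  linear_combination h2

variable {B : Submodule ℂ H} {T : B →ₗ[ℂ] B}

theorem mem_graph_endToPMap {v w : H} :
    (v, w) ∈ (endToPMap T).graph ↔ ∃ b : B, (b : H) = v ∧ (T b : H) = w := by
  rw [LinearPMap.mem_graph_iff]
  exact Iff.rfl

theorem LinearPMap.IsClosable.mem_graph_closure_endToPMap (hT : (endToPMap T).IsClosable) {v w : H} :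
    (v, w) ∈ (endToPMap T).closure.graph ↔ ∃ b : ℕ → B,
      Filter.Tendsto (fun n => (b n : H)) Filter.atTop (𝓝 v) ∧
      Filter.Tendsto (fun n => (T (b n) : H)) Filter.atTop (𝓝 w) := by
  rw [← hT.graph_closure_eq_closure_graph, ← SetLike.mem_coe, Submodule.topologicalClosure_coe,
    mem_closure_iff_seq_limit]
  constructor
  · rintro ⟨p, hp, hlim⟩
    choose b h1 h2 using fun n => mem_graph_endToPMap.1 (hp n)
    rw [Prod.tendsto_iff] at hlim
    exact ⟨b, by simpa only [h1] using hlim.1, by simpa only [h2] using hlim.2⟩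
  · rintro ⟨b, h1, h2⟩
    exact ⟨fun n => (b n, T (b n)), fun n => mem_graph_endToPMap.2 ⟨b n, rfl, rfl⟩,
      h1.prodMk_nhds h2⟩

theorem mem_graph_closure_endToPMap (b : B) :
    ((b : H), (T b : H)) ∈ (endToPMap T).closure.graph :=
  LinearPMap.le_graph_of_le (LinearPMap.le_closure _) (mem_graph_endToPMap.2 ⟨b, rfl, rfl⟩)

/-- An operator that is symmetric up to a constant factor is closable. -/
theorem isClosable_endToPMap (hB : Dense (B : Set H)) {c : ℂ}
    (hT : ∀ v w : B, ⟪(T v : H), w⟫_ℂ = c * ⟪(v : H), T w⟫_ℂ) : (endToPMap T).IsClosable := by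
  refine ⟨(endToPMap T).graph.topologicalClosure.toLinearPMap, ?_⟩
  refine (Submodule.toLinearPMap_graph_eq _ ?_).symm
  rintro ⟨v, w⟩ hvw hv
  simp only at hv
  subst hv
  rw [← SetLike.mem_coe, Submodule.topologicalClosure_coe] at hvw
  refine hB.eq_zero_of_inner_left ℂ fun b hb => ?_
  lift b to B using hb
  -- The adjoint relation against a fixed `b` passes to the closure of the graph. At `(0, w)` it
  -- makes `w` orthogonal to the dense space `B`.
  have hcl : IsClosed {p : H × H | ⟪p.2, (b : H)⟫_ℂ = c * ⟪p.1, (T b : H)⟫_ℂ} :=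
    isClosed_eq (by fun_prop) (by fun_prop)
  have hsub : ((endToPMap T).graph : Set (H × H)) ⊆
      {p : H × H | ⟪p.2, (b : H)⟫_ℂ = c * ⟪p.1, (T b : H)⟫_ℂ} := by
    rintro ⟨p, q⟩ hp
    obtain ⟨a, rfl, rfl⟩ := mem_graph_endToPMap.1 hp
    exact hT a b
  simpa using hcl.closure_subset_iff.2 hsub hvw

theorem inner_closure_endToPMap (hB : Dense (B : Set H)) {c : ℂ}
    (hT : ∀ v w : B, ⟪(T v : H), w⟫_ℂ = c * ⟪(v : H), T w⟫_ℂ) {v v' w w' : H}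
    (hv : (v, v') ∈ (endToPMap T).closure.graph) (hw : (w, w') ∈ (endToPMap T).closure.graph) :
    ⟪v', w⟫_ℂ = c * ⟪v, w'⟫_ℂ := by
  have hc := isClosable_endToPMap hB hT
  obtain ⟨a, ha1, ha2⟩ := hc.mem_graph_closure_endToPMap.1 hv
  obtain ⟨b, hb1, hb2⟩ := hc.mem_graph_closure_endToPMap.1 hw
  refine tendsto_nhds_unique (ha2.inner hb1) ?_
  simp only [hT]
  exact (ha1.inner hb2).const_mul c

end Operators

namespace PreRepresentation

variable {E G 𝔤 H : Type*} [NormedAddCommGroup E] [NormedSpace ℝ E]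
  [TopologicalSpace G] [ChartedSpace E G] [Group G] [LieGroup 𝓘(ℝ, E) ω G]
  [NormedAddCommGroup 𝔤] [NormedSpace ℝ 𝔤]
  [NormedAddCommGroup H] [InnerProductSpace ℂ H] [CompleteSpace H]
  {S : BanachLieSupergroup E G 𝔤} (R : PreRepresentation S H)

/-! ### The closures of the operators of a pre-representation -/

omit [LieGroup 𝓘(ℝ, E) ω G] in
theorem _root_.expCurve_zero (x : GroupLieAlgebra 𝓘(ℝ, E) G) : expCurve x 0 = 1 := by
  unfold expCurve
  split_ifs with h
  · exact h.choose_spec.1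
  · rfl

omit [LieGroup 𝓘(ℝ, E) ω G] [CompleteSpace H] in
theorem _root_.UnitaryRep.mem_graph_dOp {π : UnitaryRep G H} {x : GroupLieAlgebra 𝓘(ℝ, E) G} {v w : H} :
    (v, w) ∈ (π.dOp x).graph ↔ HasDerivAt (fun t => π.toHom (expCurve x t) v) w 0 :=
  mem_graph_infinitesimalGenerator

theorem inner_dOp (x : S.part 0) {v v' w w' : H}
    (hv : (v, v') ∈ (R.π.dOp (S.lieIso x)).graph) (hw : (w, w') ∈ (R.π.dOp (S.lieIso x)).graph) :
    ⟪v', w⟫_ℂ = -⟪v, w'⟫_ℂ :=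
  inner_infinitesimalGenerator (by simp [expCurve_zero]) hv hw

theorem inner_ρ_even (x : S.part 0) (v w : R.B) :
    ⟪(R.ρ x v : H), w⟫_ℂ = (-1) * ⟪(v : H), R.ρ x w⟫_ℂ := by
  rw [R.inner_dOp x (R.ρ_even x v) (R.ρ_even x w)]
  ring

/-- With `z = exp(-πi/4)`, symmetry of `zρ(y)` reads `z̄⟪ρ(y)v, w⟫ = z⟪v, ρ(y)w⟫`. Multiplying by
`z` leaves the factor `z² = -i`. -/
theorem inner_ρ_odd (y : S.part 1) (v w : R.B) :
    ⟪(R.ρ y v : H), w⟫_ℂ = (-Complex.I) * ⟪(v : H), R.ρ y w⟫_ℂ := by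
  have h := R.ρ_odd_symm y v w
  set z := Complex.exp (-(Real.pi * Complex.I / 4)) with hz
  have hz0 : z ≠ 0 := Complex.exp_ne_zero _
  have hconj : (starRingEnd ℂ) z * z = 1 := by
    have h4 : (starRingEnd ℂ) (4 : ℂ) = 4 := Complex.conj_ofNat 4
    rw [hz, ← Complex.exp_conj, ← Complex.exp_add, Complex.exp_eq_one_iff]
    refine ⟨0, ?_⟩
    simp only [map_neg, map_div₀, map_mul, Complex.conj_ofReal, Complex.conj_I, h4]
    push_cast
    ring
  have hsq : z * z = -Complex.I := by
    rw [hz, ← Complex.exp_add]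
    have : -(Real.pi * Complex.I / 4) + -(Real.pi * Complex.I / 4) = -(Real.pi / 2 * Complex.I) := by
      ring
    rw [this, Complex.exp_neg, Complex.exp_pi_div_two_mul_I, Complex.inv_I]
  simp only [LinearMap.smul_apply, Submodule.coe_inner, inner_smul_left, inner_smul_right] at h
  linear_combination z * h + hsq * ⟪(v : H), R.ρ y w⟫_ℂ - hconj * ⟪(R.ρ y v : H), w⟫_ℂ

theorem isClosable_even (x : S.part 0) : (endToPMap (R.ρ x)).IsClosable :=
  isClosable_endToPMap R.dense_B (R.inner_ρ_even x)

theorem isClosable_odd (y : S.part 1) : (endToPMap (R.ρ y)).IsClosable :=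
  isClosable_endToPMap R.dense_B (R.inner_ρ_odd y)

theorem inner_closedOp_even (x : S.part 0) {v v' w w' : H}
    (hv : (v, v') ∈ (R.closedOp x).graph) (hw : (w, w') ∈ (R.closedOp x).graph) :
    ⟪v', w⟫_ℂ = (-1) * ⟪v, w'⟫_ℂ :=
  inner_closure_endToPMap R.dense_B (R.inner_ρ_even x) hv hw

theorem inner_closedOp_odd (y : S.part 1) {v v' w w' : H}
    (hv : (v, v') ∈ (R.closedOp y).graph) (hw : (w, w') ∈ (R.closedOp y).graph) :
    ⟪v', w⟫_ℂ = (-Complex.I) * ⟪v, w'⟫_ℂ :=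
  inner_closure_endToPMap R.dense_B (R.inner_ρ_odd y) hv hw

theorem mem_graph_closedOp (x : 𝔤) (b : R.B) : ((b : H), (R.ρ x b : H)) ∈ (R.closedOp x).graph :=
  mem_graph_closure_endToPMap b

theorem isClosed_graph_closedOp_even (x : S.part 0) :
    IsClosed ((R.closedOp x).graph : Set (H × H)) :=
  (R.isClosable_even x).closure_isClosed

/-- `dπ(x)` is a restriction of the closure of `ρ(x)`. -/
theorem dOp_le_closedOp (x : S.part 0) : R.π.dOp (S.lieIso x) ≤ R.closedOp x := by
  have hadj : (R.closedOp x).adjoint = -R.closedOp x := (R.ρ_even_skew x).2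
  have hdense : Dense ((R.closedOp x).domain : Set H) :=
    R.dense_B.mono (LinearPMap.le_closure (endToPMap (R.ρ x))).1
  -- Skew-symmetry of `dπ(x)` against `B` extends to the closure of `ρ(x)`, so `-dπ(x)` lies in its
  -- adjoint. By essential skew-adjointness that adjoint is minus the closure.
  have hform : (R.closedOp x).IsFormalAdjoint (-R.π.dOp (S.lieIso x)) := by
    rintro w ⟨v, hv⟩
    have h1 : ((w : H), R.closedOp x w) ∈ (R.closedOp x).graph := LinearPMap.mem_graph _ w
    have h2 : (v, R.π.dOp (S.lieIso x) ⟨v, hv⟩) ∈ (R.π.dOp (S.lieIso x)).graph :=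
      LinearPMap.mem_graph (R.π.dOp (S.lieIso x)) ⟨v, hv⟩
    have hB : ∀ b : R.B, ⟪(R.ρ x b : H), v⟫_ℂ = -⟪(b : H), R.π.dOp (S.lieIso x) ⟨v, hv⟩⟫_ℂ :=
      fun b => R.inner_dOp x (R.ρ_even x b) h2
    obtain ⟨b, hb1, hb2⟩ := (R.isClosable_even x).mem_graph_closure_endToPMap.1 h1
    have h3 := tendsto_nhds_unique (hb2.inner tendsto_const_nhds)
      (((hb1.inner (tendsto_const_nhds (x := R.π.dOp (S.lieIso x) ⟨v, hv⟩))).neg).congr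
        fun n => (hB (b n)).symm)
    rw [← inner_neg_right] at h3
    exact h3
  have hle := hform.le_adjoint hdense
  rw [hadj] at hle
  refine ⟨hle.1, fun a b hab => ?_⟩
  have h := hle.2 (x := a) (y := b) hab
  simpa using h

theorem closedOp_graph_of_dOp (x : S.part 0) {v w : H}
    (h : (v, w) ∈ (R.π.dOp (S.lieIso x)).graph) : (v, w) ∈ (R.closedOp x).graph :=
  LinearPMap.le_graph_of_le (R.dOp_le_closedOp x) h

/-! ### The odd operators -/

/-- Since `ρ([y,y]) = 2ρ(y)²` and `‖ρ(y)v‖² = |⟪v, ρ(y)²v⟫|`, this is the Cauchy–Schwarz inequality.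
-/
theorem norm_sq_ρ_odd_le (y : S.part 1) (v : R.B) :
    ‖(R.ρ y v : H)‖ ^ 2 ≤ 1 / 2 * (‖(v : H)‖ * ‖(R.ρ (S.bracket y y) v : H)‖) := by
  have h1 := R.ρ_bracket 1 1 y y.2 y y.2 v
  have h2 : (R.ρ (S.bracket y y) v : H) = (2 : ℂ) • (R.ρ y (R.ρ y v) : H) := by
    rw [h1]
    have : (1 : ZMod 2).val = 1 := rfl
    simp [this, two_smul]
  have h3 := R.inner_ρ_odd y v (R.ρ y v)
  have h4 : ‖(R.ρ y v : H)‖ ^ 2 ≤ ‖(v : H)‖ * ‖(R.ρ y (R.ρ y v) : H)‖ := by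
    have h5 : ‖⟪(R.ρ y v : H), (R.ρ y v : H)⟫_ℂ‖ = ‖(R.ρ y v : H)‖ ^ 2 := by
      rw [inner_self_eq_norm_sq_to_K]
      simp
    rw [← h5, h3, norm_mul]
    simpa using norm_inner_le_norm (𝕜 := ℂ) (v : H) (R.ρ y (R.ρ y v) : H)
  rw [h2, norm_smul]
  norm_num
  linarith

/-- The square of an odd element, as an even element. -/
def _root_.BanachLieSuperalgebra.oddBracket (S : BanachLieSuperalgebra 𝔤) (y z : S.part 1) :
    S.part 0 :=
  ⟨S.bracket y z, S.bracket_mem 1 1 y y.2 z z.2⟩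

/-- The bracket of an even and an odd element, as an odd element. -/
def _root_.BanachLieSuperalgebra.evenOddBracket (S : BanachLieSuperalgebra 𝔤) (x : S.part 0)
    (y : S.part 1) : S.part 1 :=
  ⟨S.bracket x y, S.bracket_mem 0 1 x x.2 y y.2⟩

/-- Approximate `v` from `B` in the graph norm of `ρ([y,y])`. The quadratic bound, applied to
differences, makes the images under `ρ(y)` a Cauchy sequence. -/
theorem exists_mem_graph_closedOp_odd (y : S.part 1) {v u : H}
    (h : (v, u) ∈ (R.closedOp (S.bracket y y)).graph) :
    ∃ w, (v, w) ∈ (R.closedOp y).graph ∧ ‖w‖ ^ 2 ≤ 1 / 2 * (‖v‖ * ‖u‖) := by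
  have hc : (endToPMap (R.ρ (S.bracket y y))).IsClosable :=
    R.isClosable_even (S.oddBracket y y)
  obtain ⟨b, hb1, hb2⟩ := hc.mem_graph_closure_endToPMap.1 h
  have hcau : CauchySeq fun n => (R.ρ y (b n) : H) := by
    have e1 := hb1.cauchySeq
    have e2 := hb2.cauchySeq
    rw [Metric.cauchySeq_iff] at e1 e2 ⊢
    intro ε hε
    obtain ⟨N1, hN1⟩ := e1 ε hε
    obtain ⟨N2, hN2⟩ := e2 ε hε
    refine ⟨max N1 N2, fun m hm n hn => ?_⟩
    have f1 := hN1 m (le_of_max_le_left hm) n (le_of_max_le_left hn)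
    have f2 := hN2 m (le_of_max_le_right hm) n (le_of_max_le_right hn)
    have f3 := R.norm_sq_ρ_odd_le y (b m - b n)
    simp only [map_sub, Submodule.coe_sub, ← dist_eq_norm] at f3
    by_contra! hcon
    have f4 : ε ^ 2 ≤ dist (R.ρ y (b m) : H) (R.ρ y (b n)) ^ 2 := by gcongr
    have f5 : dist (b m : H) (b n) * dist (R.ρ (S.bracket y y) (b m) : H)
      (R.ρ (S.bracket y y) (b n)) ≤ ε * ε := by gcongr
    nlinarith
  obtain ⟨w, hw⟩ := cauchySeq_tendsto_of_complete hcau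
  refine ⟨w, (R.isClosable_odd y).mem_graph_closure_endToPMap.2 ⟨b, hb1, hw⟩, ?_⟩
  exact le_of_tendsto_of_tendsto' (hw.norm.pow 2) ((hb1.norm.mul hb2.norm).const_mul _)
    fun n => R.norm_sq_ρ_odd_le y (b n)

/-! ### The space of vectors with bounded first derivative -/

/-- The space of pairs `(v, A)` of a vector `v` and a continuous linear map `A`. -/
def _root_.FirstJet (W H : Type*) [NormedAddCommGroup W] [NormedSpace ℝ W] [NormedAddCommGroup H]
    [NormedSpace ℝ H] : Type _ := H × (W →L[ℝ] H)

section FirstJet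

variable (W H : Type*) [NormedAddCommGroup W] [NormedSpace ℝ W] [NormedAddCommGroup H]
  [NormedSpace ℝ H]

instance : NormedAddCommGroup (FirstJet W H) := inferInstanceAs (NormedAddCommGroup (H × (W →L[ℝ] H)))

instance : NormedSpace ℝ (FirstJet W H) := inferInstanceAs (NormedSpace ℝ (H × (W →L[ℝ] H)))

instance [CompleteSpace H] : CompleteSpace (FirstJet W H) :=
  inferInstanceAs (CompleteSpace (H × (W →L[ℝ] H)))

variable {W H}

@[simp] theorem _root_.FirstJet.fst_add (k l : FirstJet W H) : (k + l).1 = k.1 + l.1 := rfl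

@[simp] theorem _root_.FirstJet.fst_smul (c : ℝ) (k : FirstJet W H) : (c • k).1 = c • k.1 := rfl

end FirstJet

/-- The pairs `(v, A)` where `A : 𝔤₀ → H` is continuous and `A x` is the value at `v` of the
closure of `ρ(x)`. -/
def jetSpace : Submodule ℝ (FirstJet (S.part 0) H) where
  carrier := {k | ∀ x : S.part 0, (k.1, k.2 x) ∈ (R.closedOp x).graph}
  add_mem' := fun ha hb x => add_mem (ha x) (hb x)
  zero_mem' := fun x => zero_mem (R.closedOp x).graph
  smul_mem' := fun c k hk x => by
    have h := (R.closedOp x).graph.smul_mem (c : ℂ) (hk x)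
    rw [Complex.coe_smul] at h
    exact h

theorem isClosed_jetSpace : IsClosed (R.jetSpace : Set (FirstJet (S.part 0) H)) := by
  have : (R.jetSpace : Set (FirstJet (S.part 0) H)) =
      ⋂ x : S.part 0, (fun k : FirstJet (S.part 0) H => (k.1, k.2 x)) ⁻¹'
        ((R.closedOp x).graph : Set (H × H)) := by
    ext k
    simp [jetSpace]
  rw [this]
  refine isClosed_iInter fun x => (R.isClosed_graph_closedOp_even x).preimage ?_
  have h : Continuous fun k : H × (S.part 0 →L[ℝ] H) => (k.1, k.2 x) := by fun_prop
  exact h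

instance : CompleteSpace R.jetSpace := R.isClosed_jetSpace.completeSpace_coe

theorem exists_odd_jet (y : S.part 1) (k : R.jetSpace) :
    ∃ w, (k.1.1, w) ∈ (R.closedOp y).graph ∧ ‖w‖ ^ 2 ≤ 1 / 2 * (‖k.1.1‖ * ‖k.1.2 (S.oddBracket y y)‖) :=
  R.exists_mem_graph_closedOp_odd y (k.2 (S.oddBracket y y))

theorem norm_oddBracket_le (y : S.part 1) : ‖S.oddBracket y y‖ ≤ ‖y‖ * ‖y‖ :=
  S.norm_bracket_le y y

theorem norm_evenOddBracket_le (x : S.part 0) (y : S.part 1) :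
    ‖S.evenOddBracket x y‖ ≤ ‖x‖ * ‖y‖ :=
  S.norm_bracket_le x y

/-- Later identities between values of closed operators are tested this way: adjunction moves each
operator onto `B`, where `ρ` is everywhere defined. -/
theorem eq_of_inner_B {v w : H} (h : ∀ b : R.B, ⟪v, (b : H)⟫_ℂ = ⟪w, (b : H)⟫_ℂ) : v = w :=
  R.dense_B.eq_of_inner_left ℂ fun b hb => h ⟨b, hb⟩

/-- The value `ρ(y) v` of the closure of `ρ(y)`, `y` odd, as a function of `y` and `(v, A)`. -/
def oddJet : S.part 1 →L[ℝ] R.jetSpace →L[ℝ] H :=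
  LinearMap.mkContinuous₂
    (LinearMap.mk₂ ℝ (fun y k => (R.exists_odd_jet y k).choose)
      (fun y z k => by
        refine R.eq_of_inner_B fun b => ?_
        rw [inner_add_left,
          R.inner_closedOp_odd _ (R.exists_odd_jet (y + z) k).choose_spec.1 (R.mem_graph_closedOp _ b),
          R.inner_closedOp_odd _ (R.exists_odd_jet y k).choose_spec.1 (R.mem_graph_closedOp _ b),
          R.inner_closedOp_odd _ (R.exists_odd_jet z k).choose_spec.1 (R.mem_graph_closedOp _ b)]
        simp [mul_add])
      (fun c y k => by
        refine R.eq_of_inner_B fun b => ?_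
        rw [← Complex.coe_smul, inner_smul_left,
          R.inner_closedOp_odd _ (R.exists_odd_jet (c • y) k).choose_spec.1 (R.mem_graph_closedOp _ b),
          R.inner_closedOp_odd _ (R.exists_odd_jet y k).choose_spec.1 (R.mem_graph_closedOp _ b)]
        have : ((R.ρ ((c • y : S.part 1) : 𝔤) b : R.B) : H) = (c : ℂ) • ((R.ρ y b : R.B) : H) := by
          simp
        rw [this, inner_smul_right, Complex.conj_ofReal]
        ring)
      (fun y k l => by
        refine R.eq_of_inner_B fun b => ?_
        rw [inner_add_left,
          R.inner_closedOp_odd _ (R.exists_odd_jet y (k + l)).choose_spec.1 (R.mem_graph_closedOp _ b),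
          R.inner_closedOp_odd _ (R.exists_odd_jet y k).choose_spec.1 (R.mem_graph_closedOp _ b),
          R.inner_closedOp_odd _ (R.exists_odd_jet y l).choose_spec.1 (R.mem_graph_closedOp _ b)]
        simp [mul_add])
      (fun c y k => by
        refine R.eq_of_inner_B fun b => ?_
        rw [← Complex.coe_smul, inner_smul_left,
          R.inner_closedOp_odd _ (R.exists_odd_jet y (c • k)).choose_spec.1 (R.mem_graph_closedOp _ b),
          R.inner_closedOp_odd _ (R.exists_odd_jet y k).choose_spec.1 (R.mem_graph_closedOp _ b)]
        have : (c • k : R.jetSpace).1.1 = (c : ℂ) • k.1.1 := by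
          simp
        rw [this, inner_smul_left]
        ring))
    -- The quadratic bound gives the constant `1/√2`; any finite constant serves for continuity.
    1 (fun y k => by
      have h := (R.exists_odd_jet y k).choose_spec.2
      change ‖(R.exists_odd_jet y k).choose‖ ≤ _
      have h1 : ‖k.1.1‖ ≤ ‖k‖ := norm_fst_le k.1
      have h2 : ‖k.1.2‖ ≤ ‖k‖ := norm_snd_le k.1
      have h3 : ‖k.1.2 (S.oddBracket y y)‖ ≤ ‖k‖ * (‖y‖ * ‖y‖) :=
        (k.1.2.le_opNorm _).trans (by gcongr; exact norm_oddBracket_le y)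
      have h4 : ‖k.1.1‖ * ‖k.1.2 (S.oddBracket y y)‖ ≤ ‖k‖ * (‖k‖ * (‖y‖ * ‖y‖)) := by
        gcongr
      refine le_of_sq_le_sq ?_ (by positivity)
      nlinarith [norm_nonneg k, norm_nonneg y, sq_nonneg (‖k‖ * ‖y‖)])

theorem oddJet_mem_graph (y : S.part 1) (k : R.jetSpace) :
    (k.1.1, R.oddJet y k) ∈ (R.closedOp y).graph :=
  (R.exists_odd_jet y k).choose_spec.1

theorem norm_sq_oddJet_le (y : S.part 1) (k : R.jetSpace) :
    ‖R.oddJet y k‖ ^ 2 ≤ 1 / 2 * (‖k.1.1‖ * ‖k.1.2 (S.oddBracket y y)‖) :=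
  (R.exists_odd_jet y k).choose_spec.2

theorem inner_oddJet (y : S.part 1) (k : R.jetSpace) (b : R.B) :
    ⟪R.oddJet y k, (b : H)⟫_ℂ = (-Complex.I) * ⟪k.1.1, R.ρ y b⟫_ℂ :=
  R.inner_closedOp_odd y (R.oddJet_mem_graph y k) (R.mem_graph_closedOp _ b)

/-- The weak form of the commutation relation of an even and an odd element. -/
theorem inner_oddJet_closedOp (x : S.part 0) (y : S.part 1) {k k' : R.jetSpace}
    (hk : k'.1.1 = k.1.2 x) {w w' : H} (hw : (w, w') ∈ (R.closedOp x).graph) :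
    ⟪R.oddJet y k, w'⟫_ℂ = -⟪R.oddJet y k' + R.oddJet (S.evenOddBracket x y) k, w⟫_ℂ := by
  have hB : ∀ b : R.B, ⟪R.oddJet y k, (R.ρ x b : H)⟫_ℂ =
      -⟪R.oddJet y k' + R.oddJet (S.evenOddBracket x y) k, (b : H)⟫_ℂ := by
    intro b
    have h1 : R.ρ (S.bracket x y) b = R.ρ x (R.ρ y b) - R.ρ y (R.ρ x b) := by
      simpa using R.ρ_bracket 0 1 x x.2 y y.2 b
    have h2 := R.inner_closedOp_even x (k.2 x) (R.mem_graph_closedOp x (R.ρ y b))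
    have h3 := R.inner_oddJet (S.evenOddBracket x y) k b
    have h4 : ((S.evenOddBracket x y : S.part 1) : 𝔤) = S.bracket x y := rfl
    rw [h4, h1, Submodule.coe_sub, inner_sub_right] at h3
    rw [inner_add_left, R.inner_oddJet, R.inner_oddJet, h3, hk, h2]
    ring
  obtain ⟨b, hb1, hb2⟩ := (R.isClosable_even x).mem_graph_closure_endToPMap.1 hw
  refine tendsto_nhds_unique (tendsto_const_nhds.inner hb2) ?_
  simp only [hB]
  exact (tendsto_const_nhds.inner hb1).neg

end PreRepresentation

/-! ### One-parameter subgroups of Banach--Lie groups -/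

section LieGroup

variable {E G F : Type*} [NormedAddCommGroup E] [NormedSpace ℝ E]
  [TopologicalSpace G] [ChartedSpace E G] [Group G] [LieGroup 𝓘(ℝ, E) ω G]
  [NormedAddCommGroup F] [NormedSpace ℝ F]

variable (E G) in
include E in
theorem LieGroup.t2Space : T2Space G := by
  have : IsTopologicalGroup G := topologicalGroup_of_lieGroup 𝓘(ℝ, E) ω
  have : T1Space G := ChartedSpace.t1Space E G
  infer_instance

omit [LieGroup 𝓘(ℝ, E) ω G] in
theorem mulInvariantVectorField_one (x : GroupLieAlgebra 𝓘(ℝ, E) G) :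
    mulInvariantVectorField x (1 : G) = x := by
  have : (fun k : G => 1 * k) = id := by ext; simp
  unfold mulInvariantVectorField
  rw [mfderiv_congr this, mfderiv_id]
  rfl

theorem mfderiv_mul_left_mulInvariantVectorField (x : GroupLieAlgebra 𝓘(ℝ, E) G) (g h : G) :
    mfderiv 𝓘(ℝ, E) 𝓘(ℝ, E) (fun k : G => g * k) h (mulInvariantVectorField x h) =
      mulInvariantVectorField x (g * h) := by
  unfold mulInvariantVectorField
  have h1 : (fun k : G => g * h * k) = (fun k : G => g * k) ∘ (fun k : G => h * k) := by
    ext; simp [mul_assoc]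
  have h2 : HasMFDerivAt 𝓘(ℝ, E) 𝓘(ℝ, E) (fun k : G => g * k) (h * 1)
      (mfderiv 𝓘(ℝ, E) 𝓘(ℝ, E) (fun k : G => g * k) h) := by
    rw [mul_one]
    exact (contMDiff_mul_left (I := 𝓘(ℝ, E)) (n := ω)).mdifferentiableAt (by simp) |>.hasMFDerivAt
  have h3 : HasMFDerivAt 𝓘(ℝ, E) 𝓘(ℝ, E) (fun k : G => h * k) 1
      (mfderiv 𝓘(ℝ, E) 𝓘(ℝ, E) (fun k : G => h * k) 1) :=
    (contMDiff_mul_left (I := 𝓘(ℝ, E)) (n := ω)).mdifferentiableAt (by simp) |>.hasMFDerivAt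
  have h4 := (h2.comp (1 : G) h3).mfderiv
  rw [mfderiv_congr h1, h4]
  rfl

theorem IsMIntegralCurveOn.mul_left {x : GroupLieAlgebra 𝓘(ℝ, E) G} {γ : ℝ → G} {s : Set ℝ}
    (hγ : IsMIntegralCurveOn (I := 𝓘(ℝ, E)) γ (mulInvariantVectorField x) s) (g : G) :
    IsMIntegralCurveOn (I := 𝓘(ℝ, E)) (fun t => g * γ t) (mulInvariantVectorField x) s := by
  intro t ht
  have h0 : MDifferentiableAt 𝓘(ℝ, E) 𝓘(ℝ, E) (fun k : G => g * k) (γ t) :=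
    (contMDiff_mul_left (I := 𝓘(ℝ, E)) (n := ω)).mdifferentiableAt (by simp)
  have h1 := h0.hasMFDerivAt.comp_hasMFDerivWithinAt t (hγ t ht)
  refine h1.congr_mfderiv (ContinuousLinearMap.ext_ring ?_)
  have h2 := mfderiv_mul_left_mulInvariantVectorField x g (γ t)
  have h3 := ContinuousLinearMap.map_smul (mfderiv 𝓘(ℝ, E) 𝓘(ℝ, E) (fun k : G => g * k) (γ t)) (1 : ℝ)
    (mulInvariantVectorField x (γ t))
  rw [h2] at h3
  exact h3

theorem IsMIntegralCurve.mul_left {x : GroupLieAlgebra 𝓘(ℝ, E) G} {γ : ℝ → G}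
    (hγ : IsMIntegralCurve (I := 𝓘(ℝ, E)) γ (mulInvariantVectorField x)) (g : G) :
    IsMIntegralCurve (I := 𝓘(ℝ, E)) (fun t => g * γ t) (mulInvariantVectorField x) := by
  rw [isMIntegralCurve_iff_isMIntegralCurveOn] at *
  exact hγ.mul_left g

theorem contMDiff_one_mulInvariantVectorField (x : GroupLieAlgebra 𝓘(ℝ, E) G) :
    ContMDiff 𝓘(ℝ, E) 𝓘(ℝ, E).tangent 1
      (fun g : G => (⟨g, mulInvariantVectorField x g⟩ : TangentBundle 𝓘(ℝ, E) G)) :=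
  (contMDiff_mulInvariantVectorField x).of_le (by simp)

variable [CompleteSpace E]

/-- Left translation carries the local integral curve at `1` to every point with the same lifetime,
and a uniform lifetime gives a global curve. Thus `expCurve` never takes its default value here. -/
theorem exists_isMIntegralCurve_mulInvariantVectorField (x : GroupLieAlgebra 𝓘(ℝ, E) G) :
    ∃ γ : ℝ → G, γ 0 = 1 ∧ IsMIntegralCurve (I := 𝓘(ℝ, E)) γ (mulInvariantVectorField x) := by
  have : T2Space G := LieGroup.t2Space E G
  obtain ⟨γ, h0, hγ⟩ := exists_isMIntegralCurveAt_of_contMDiffAt_boundaryless (I := 𝓘(ℝ, E)) 0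
    (contMDiff_one_mulInvariantVectorField x).contMDiffAt (x₀ := (1 : G))
  rw [isMIntegralCurveAt_iff'] at hγ
  obtain ⟨ε, hε, hγ⟩ := hγ
  rw [Real.ball_eq_Ioo, zero_sub, zero_add] at hγ
  exact exists_isMIntegralCurve_of_isMIntegralCurveOn (contMDiff_one_mulInvariantVectorField x) hε
    (fun g => ⟨fun t => g * γ t, by simp [h0], hγ.mul_left g⟩) 1

theorem isMIntegralCurve_expCurve (x : GroupLieAlgebra 𝓘(ℝ, E) G) :
    IsMIntegralCurve (I := 𝓘(ℝ, E)) (expCurve x) (mulInvariantVectorField x) := by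
  have h := exists_isMIntegralCurve_mulInvariantVectorField x
  unfold expCurve
  rw [dif_pos h]
  exact h.choose_spec.2

/-- As functions of `t`, both sides are integral curves of the same field that agree at `0`. -/
theorem expCurve_add (x : GroupLieAlgebra 𝓘(ℝ, E) G) (s t : ℝ) :
    expCurve x (s + t) = expCurve x s * expCurve x t := by
  have : T2Space G := LieGroup.t2Space E G
  have h1 := (isMIntegralCurve_expCurve x).comp_add s
  have h2 := (isMIntegralCurve_expCurve x).mul_left (expCurve x s)
  have h3 := isMIntegralCurve_Ioo_eq_of_contMDiff_boundaryless (t₀ := 0)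
    (contMDiff_one_mulInvariantVectorField x) h1 h2 (by simp [expCurve_zero])
  have h4 := congrFun h3 t
  simpa [add_comm] using h4

theorem hasMFDerivAt_expCurve (x : GroupLieAlgebra 𝓘(ℝ, E) G) :
    HasMFDerivAt 𝓘(ℝ, ℝ) 𝓘(ℝ, E) (expCurve x) 0
      ((1 : ℝ →L[ℝ] ℝ).smulRight (mulInvariantVectorField x (expCurve x 0))) :=
  isMIntegralCurve_expCurve x 0

variable (E) in
/-- The derivative at `1` of a map from a Lie group to a normed space. -/
def mfderivOne (f : G → F) : E →L[ℝ] F := mfderiv 𝓘(ℝ, E) 𝓘(ℝ, F) f (1 : G)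

theorem hasDerivAt_comp_expCurve {f : G → F} (hf : MDifferentiableAt 𝓘(ℝ, E) 𝓘(ℝ, F) f 1)
    (x : GroupLieAlgebra 𝓘(ℝ, E) G) :
    HasDerivAt (fun t => f (expCurve x t)) (mfderivOne E f x) 0 := by
  have h0 : HasMFDerivAt 𝓘(ℝ, ℝ) 𝓘(ℝ, E) (expCurve x) 0
      ((1 : ℝ →L[ℝ] ℝ).smulRight (mulInvariantVectorField x (1 : G))) := by
    have := hasMFDerivAt_expCurve x
    rwa [expCurve_zero] at this
  have hf' : HasMFDerivAt 𝓘(ℝ, E) 𝓘(ℝ, F) f (expCurve x 0) (mfderivOne (F := F) E f) := by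
    rw [expCurve_zero]
    exact hf.hasMFDerivAt
  have h1 : HasFDerivAt (f ∘ expCurve x) (mfderivOne E f ∘L
      ((1 : ℝ →L[ℝ] ℝ).smulRight (show E from mulInvariantVectorField x (1 : G)))) 0 :=
    (hf'.comp 0 h0).hasFDerivAt
  refine h1.hasDerivAt.congr_deriv ?_
  rw [mulInvariantVectorField_one]
  exact congrArg (mfderivOne E f) (one_smul ℝ (show E from x))

omit [CompleteSpace E] in
/-- The partial derivative at `1` in the second variable of a smooth map `G × G → F` is smooth. -/
theorem contMDiff_mfderivOne {f : G → G → F}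
    (hf : ContMDiff (𝓘(ℝ, E).prod 𝓘(ℝ, E)) 𝓘(ℝ, F) ∞ (Function.uncurry f)) :
    ContMDiff 𝓘(ℝ, E) 𝓘(ℝ, E →L[ℝ] F) ∞ (fun g => mfderivOne E (f g)) := by
  intro g₀
  have h := ContMDiffAt.mfderiv (x₀ := g₀) f (fun _ => (1 : G)) (m := ∞) (n := ∞) hf.contMDiffAt
    contMDiffAt_const (by simp)
  refine h.congr_of_eventuallyEq (Filter.Eventually.of_forall fun g => ?_)
  -- The base point is constantly `1`, so the coordinate changes that appear are the identity.
  refine Eq.symm ((inTangentCoordinates_eq (I := 𝓘(ℝ, E)) (I' := 𝓘(ℝ, F)) (fun _ : G => (1 : G))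
    (fun g => f g 1) (fun g => mfderivOne E (f g)) (x₀ := g₀) (x := g)
    (mem_chart_source E (1 : G)) (mem_chart_source F (f g 1))).trans ?_)
  ext x
  simp only [tangentBundleCore_coordChange_model_space]
  have h2 := (tangentBundleCore 𝓘(ℝ, E) G).coordChange_self (achart E (1 : G)) 1
    (mem_chart_source E (1 : G)) x
  exact congrArg (mfderivOne E (f g)) h2

end LieGroup

/-! ### Derivatives of orbit maps -/

namespace UnitaryRep

variable {E G H : Type*} [NormedAddCommGroup E] [NormedSpace ℝ E]
  [TopologicalSpace G] [ChartedSpace E G] [Group G] [LieGroup 𝓘(ℝ, E) ω G]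
  [NormedAddCommGroup H] [InnerProductSpace ℂ H] (π : UnitaryRep G H)

variable (E) in
/-- The derivative `x ↦ dπ(x) v` of the orbit map of `v` at `1`. -/
def orbitDeriv (v : H) : E →L[ℝ] H := mfderivOne E (fun g : G => π.toHom g v)

theorem toHom_mem_smoothVectors {v : H} (hv : v ∈ π.smoothVectors E) (g : G) :
    π.toHom g v ∈ π.smoothVectors E := by
  have h := ContMDiff.comp (I' := 𝓘(ℝ, E)) (show ContMDiff 𝓘(ℝ, E) 𝓘(ℝ, H) ∞ _ from hv)
    (contMDiff_mul_right (I := 𝓘(ℝ, E)) (n := ∞) (a := g))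
  refine h.congr fun k => ?_
  simp

/-- The map `(g, h) ↦ π(hg)v` is smooth because the orbit map of `v` and the multiplication are;
differentiate it in `h` at `1`. -/
theorem contMDiff_orbitDeriv {v : H} (hv : v ∈ π.smoothVectors E) :
    ContMDiff 𝓘(ℝ, E) 𝓘(ℝ, E →L[ℝ] H) ∞ (fun g : G => π.orbitDeriv E (π.toHom g v)) := by
  refine contMDiff_mfderivOne (E := E) (f := fun g h : G => π.toHom h (π.toHom g v)) ?_
  have h := ContMDiff.comp (I' := 𝓘(ℝ, E)) (show ContMDiff 𝓘(ℝ, E) 𝓘(ℝ, H) ∞ _ from hv)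
    ((contMDiff_snd (I := 𝓘(ℝ, E)) (J := 𝓘(ℝ, E)) (n := ∞) (M := G) (N := G)).mul contMDiff_fst)
  refine h.congr fun k => ?_
  simp [Function.uncurry]

variable [CompleteSpace E]

theorem mem_graph_dOp_orbitDeriv {v : H} (hv : v ∈ π.smoothVectors E)
    (x : GroupLieAlgebra 𝓘(ℝ, E) G) : (v, π.orbitDeriv E v x) ∈ (π.dOp x).graph := by
  rw [mem_graph_dOp]
  exact hasDerivAt_comp_expCurve (ContMDiff.mdifferentiable hv (by simp) 1) x

/-- The vector `π(g)dπ(x)v` is the derivative of `h ↦ π(gh)v` at `1` in direction `x`, which depends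
smoothly on `g`. -/
theorem orbitDeriv_mem_smoothVectors {v : H} (hv : v ∈ π.smoothVectors E) (x : E) :
    π.orbitDeriv E v x ∈ π.smoothVectors E := by
  have h1 : ContMDiff 𝓘(ℝ, E) 𝓘(ℝ, E →L[ℝ] H) ∞
      (fun g : G => mfderivOne E (fun h : G => π.toHom (g * h) v)) := by
    refine contMDiff_mfderivOne (E := E) (f := fun g h : G => π.toHom (g * h) v) ?_
    exact ContMDiff.comp (I' := 𝓘(ℝ, E)) (show ContMDiff 𝓘(ℝ, E) 𝓘(ℝ, H) ∞ _ from hv)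
      ((contMDiff_fst (I := 𝓘(ℝ, E)) (J := 𝓘(ℝ, E)) (n := ∞) (M := G) (N := G)).mul contMDiff_snd)
  have h2 : ContMDiff 𝓘(ℝ, E) 𝓘(ℝ, H) ∞
      (fun g : G => mfderivOne E (fun h : G => π.toHom (g * h) v) x) :=
    ((ContinuousLinearMap.apply ℝ H x).contMDiff (n := ∞)).comp h1
  refine ContMDiff.congr h2 fun g => ?_
  have h3 := mem_graph_dOp.1 (π.mem_graph_dOp_orbitDeriv hv x)
  have h4 := ((π.toHom g).toContinuousLinearEquiv.toContinuousLinearMap.restrictScalars ℝ).hasFDerivAt.comp_hasDerivAt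
    (0 : ℝ) h3
  have h5 : MDifferentiableAt 𝓘(ℝ, E) 𝓘(ℝ, H) (fun h : G => π.toHom (g * h) v) 1 :=
    (ContMDiff.comp (I' := 𝓘(ℝ, E)) (show ContMDiff 𝓘(ℝ, E) 𝓘(ℝ, H) ∞ _ from hv)
      (contMDiff_mul_left (I := 𝓘(ℝ, E)) (n := ∞) (a := g))).mdifferentiable (by simp) 1
  have h6 := hasDerivAt_comp_expCurve h5 x
  refine h4.unique (h6.congr_of_eventuallyEq (Filter.Eventually.of_forall fun t => ?_))
  simp

end UnitaryRep

namespace PreRepresentation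

variable {E G 𝔤 H : Type*} [NormedAddCommGroup E] [NormedSpace ℝ E] [CompleteSpace E]
  [TopologicalSpace G] [ChartedSpace E G] [Group G] [LieGroup 𝓘(ℝ, E) ω G]
  [NormedAddCommGroup 𝔤] [NormedSpace ℝ 𝔤]
  [NormedAddCommGroup H] [InnerProductSpace ℂ H] [CompleteSpace H]
  {S : BanachLieSupergroup E G 𝔤} (R : PreRepresentation S H)

variable (S) in
/-- The identification of `𝔤₀` with the model space of `G`. -/
def _root_.BanachLieSupergroup.lieIsoL : S.part 0 →L[ℝ] E := S.lieIso.toContinuousLinearMap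

/-- The `1`-jet at `1` of the orbit map of a smooth vector. -/
def jet (v : R.Hinf) : R.jetSpace :=
  ⟨((v : H), (R.π.orbitDeriv E (v : H)).comp S.lieIsoL), fun x =>
    R.closedOp_graph_of_dOp x (R.π.mem_graph_dOp_orbitDeriv v.2 (S.lieIso x))⟩

@[simp] theorem jet_fst (v : R.Hinf) : (R.jet v).1.1 = v := rfl

omit [CompleteSpace E] in
-- The second component consists of values of single-valued operators at the first.
theorem jetSpace_ext {k l : R.jetSpace} (h : k.1.1 = l.1.1) : k = l := by
  refine Subtype.ext (Prod.ext h ?_)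
  ext x
  exact LinearPMap.mem_graph_snd_inj _ (k.2 x) (l.2 x) h

/-- The action of `G` on the smooth vectors. -/
def act (g : G) (v : R.Hinf) : R.Hinf := ⟨R.π.toHom g v, R.π.toHom_mem_smoothVectors v.2 g⟩

omit [CompleteSpace E] in
@[simp] theorem coe_act (g : G) (v : R.Hinf) : (R.act g v : H) = R.π.toHom g v := rfl

/-- Both components are smooth in the ambient Banach space, and `jetSpace` is a closed subspace of
it. -/
theorem contMDiff_jet_act (v : R.Hinf) :
    ContMDiff 𝓘(ℝ, E) 𝓘(ℝ, R.jetSpace) ∞ (fun g : G => R.jet (R.act g v)) := by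
  have : IsManifold 𝓘(ℝ, E) ∞ G := IsManifold.of_le (n := ω) le_top
  refine ContMDiff.of_linearIsometry_comp R.jetSpace.subtypeₗᵢ ?_
  have h1 : ContMDiff 𝓘(ℝ, E) 𝓘(ℝ, S.part 0 →L[ℝ] H) ∞
      (fun g : G => (R.π.orbitDeriv E (R.π.toHom g (v : H))).comp S.lieIsoL) :=
    (((ContinuousLinearMap.compL ℝ (S.part 0) E H).flip S.lieIsoL).contMDiff (n := ∞)).comp
      (R.π.contMDiff_orbitDeriv v.2)
  exact ContMDiff.prodMk_space (show ContMDiff 𝓘(ℝ, E) 𝓘(ℝ, H) ∞ _ from v.2) h1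

end PreRepresentation

/-! ### Closed subgroups containing all one-parameter subgroups -/

section LieGroup

variable {E G : Type*} [NormedAddCommGroup E] [NormedSpace ℝ E] [CompleteSpace E]
  [TopologicalSpace G] [ChartedSpace E G] [Group G] [LieGroup 𝓘(ℝ, E) ω G]

/-- Through each point of a chart there are translated one-parameter groups of any velocity. -/
theorem exists_hasDerivAt_chartAt_mul_expCurve {g g₀ : G} (hg : g ∈ (chartAt E g₀).source) (ξ : E) :
    ∃ x : GroupLieAlgebra 𝓘(ℝ, E) G, HasDerivAt (fun t => chartAt E g₀ (g * expCurve x t)) ξ 0 := by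
  have : IsManifold 𝓘(ℝ, E) ∞ G := IsManifold.of_le (n := ω) le_top
  set φ := chartAt E g₀ with hφ
  have hf : MDifferentiableAt 𝓘(ℝ, E) 𝓘(ℝ, E) (fun h : G => φ (g * h)) 1 := by
    have h1 : MDifferentiableAt 𝓘(ℝ, E) 𝓘(ℝ, E) φ (g * 1) := by
      rw [mul_one]
      exact ((contMDiffOn_chart (n := ∞)).contMDiffAt (φ.open_source.mem_nhds hg)).mdifferentiableAt
        (by simp)
    exact h1.comp (1 : G) ((contMDiff_mul_left (I := 𝓘(ℝ, E)) (n := ω)).mdifferentiableAt (by simp))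
  have hψ : MDifferentiableAt 𝓘(ℝ, E) 𝓘(ℝ, E) (fun p : E => g⁻¹ * φ.symm p) (φ g) := by
    have h1 : MDifferentiableAt 𝓘(ℝ, E) 𝓘(ℝ, E) φ.symm (φ g) :=
      ((contMDiffOn_chart_symm (n := ∞)).contMDiffAt
        (φ.open_target.mem_nhds (φ.map_source hg))).mdifferentiableAt (by simp)
    exact ((contMDiff_mul_left (I := 𝓘(ℝ, E)) (n := ω)).mdifferentiableAt (by simp)).comp (φ g) h1
  have hψ1 : g⁻¹ * φ.symm (φ g) = 1 := by rw [φ.left_inv hg]; simp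
  have hf' : HasMFDerivAt 𝓘(ℝ, E) 𝓘(ℝ, E) (fun h : G => φ (g * h)) (g⁻¹ * φ.symm (φ g))
      (mfderivOne (F := E) E fun h : G => φ (g * h)) := by
    rw [hψ1]
    exact hf.hasMFDerivAt
  have hcomp' := HasMFDerivAt.comp (φ g) hf' hψ.hasMFDerivAt
  have hcomp : HasFDerivAt (fun p => φ (g * (g⁻¹ * φ.symm p)))
      (mfderivOne (F := E) E (fun h : G => φ (g * h)) ∘L
        (show E →L[ℝ] E from mfderiv 𝓘(ℝ, E) 𝓘(ℝ, E) (fun p : E => g⁻¹ * φ.symm p) (φ g))) (φ g) :=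
    hcomp'.hasFDerivAt
  have heq : (id : E → E) =ᶠ[𝓝 (φ g)] fun p => φ (g * (g⁻¹ * φ.symm p)) := by
    filter_upwards [φ.open_target.mem_nhds (φ.map_source hg)] with p hp
    simp [φ.right_inv hp]
  have hid := hcomp.congr_of_eventuallyEq heq
  have huniq := hid.unique (hasFDerivAt_id (φ g))
  -- The map `p ↦ g⁻¹ φ⁻¹(p)` is a local right inverse of `h ↦ φ(gh)`, so its derivative turns `ξ`
  -- into a suitable `x`.
  refine ⟨mfderiv 𝓘(ℝ, E) 𝓘(ℝ, E) (fun p : E => g⁻¹ * φ.symm p) (φ g) ξ, ?_⟩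
  exact (hasDerivAt_comp_expCurve hf _).congr_deriv (DFunLike.congr_fun huniq ξ)

/-- In the chart at `1`, `N` is closed near the base point, and the curves `p · exp(tx)` inside it
have every velocity. Hence `N` contains a neighbourhood of `1` and is clopen; local surjectivity of
the exponential map is not needed. -/
theorem Subgroup.connectedComponent_one_subset_of_expCurve_mem (N : Subgroup G)
    (hN : IsClosed (N : Set G)) (h : ∀ (x : GroupLieAlgebra 𝓘(ℝ, E) G) (t : ℝ), expCurve x t ∈ N) :
    connectedComponent (1 : G) ⊆ N := by
  have : IsTopologicalGroup G := topologicalGroup_of_lieGroup 𝓘(ℝ, E) ω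
  set φ := chartAt E (1 : G) with hφ
  have h1 : (1 : G) ∈ φ.source := mem_chart_source E 1
  obtain ⟨R, hR, hball⟩ := Metric.nhds_basis_closedBall.mem_iff.1
    (φ.open_target.mem_nhds (φ.map_source h1))
  have hsub : Metric.ball (φ 1) (R / 2) ⊆ φ.target ∩ φ.symm ⁻¹' (N : Set G) := by
    refine ball_subset_of_forall_hasDerivAt hR ⟨φ.map_source h1, ?_⟩ ?_ ?_
    · simp [φ.left_inv h1, N.one_mem]
    · have h2 := (φ.continuousOn_symm.mono hball).preimage_isClosed_of_isClosed
        Metric.isClosed_closedBall hN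
      convert h2 using 1
      ext p
      simp only [Set.mem_inter_iff]
      constructor
      · rintro ⟨⟨-, h3⟩, h4⟩
        exact ⟨h4, h3⟩
      · rintro ⟨h3, h4⟩
        exact ⟨⟨hball h3, h4⟩, h3⟩
    · rintro p ⟨⟨hp, hpN⟩, -⟩ ξ
      obtain ⟨x, hx⟩ := exists_hasDerivAt_chartAt_mul_expCurve (φ.map_target hp) ξ
      refine ⟨_, ?_, hx, ?_⟩
      · rw [expCurve_zero, mul_one]
        exact φ.right_inv hp
      · have hcont : ContinuousAt (fun t => φ.symm p * expCurve x t) 0 :=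
          continuousAt_const.mul (hasMFDerivAt_expCurve x).continuousAt
        have hmem := hcont.eventually_mem (s := φ.source) (by
          rw [expCurve_zero, mul_one]
          exact φ.open_source.mem_nhds (φ.map_target hp))
        filter_upwards [hmem] with t ht
        refine ⟨φ.map_source ht, ?_⟩
        rw [Set.mem_preimage, φ.left_inv ht]
        exact N.mul_mem hpN (h x t)
  have hnhds : (N : Set G) ∈ 𝓝 (1 : G) := by
    filter_upwards [φ.open_source.mem_nhds h1,
      (φ.continuousAt h1).preimage_mem_nhds (Metric.ball_mem_nhds _ (half_pos hR))] with g hg hg'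
    have h5 := (hsub hg').2
    rwa [Set.mem_preimage, φ.left_inv hg] at h5
  exact IsClopen.connectedComponent_subset ⟨hN, N.isOpen_of_mem_nhds hnhds⟩ N.one_mem

end LieGroup

/-! ### Derivatives of curves in subspaces and of pairings -/

theorem Submodule.hasDerivAt_of_coe {V : Type*} [NormedAddCommGroup V] [NormedSpace ℝ V]
    {p : Submodule ℝ V} {f : ℝ → p} {d : p} {t : ℝ} (h : HasDerivAt (fun s => (f s : V)) d t) :
    HasDerivAt f d t := by
  rw [hasDerivAt_iff_isLittleO] at h ⊢
  exact (Asymptotics.isLittleO_norm_left.1 ((Asymptotics.isLittleO_norm_left.2 h).congr_left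
    fun s => rfl))

theorem hasDerivAt_inner_bilinear {V W H : Type*} [NormedAddCommGroup V] [NormedSpace ℝ V]
    [NormedAddCommGroup W] [NormedSpace ℝ W] [NormedAddCommGroup H] [InnerProductSpace ℂ H]
    (L : V →L[ℝ] W →L[ℝ] H) {f : ℝ → V} {g : ℝ → W} {h : ℝ → H} {f' : V} {g' : W} {h' : H} {t : ℝ}
    (hf : HasDerivAt f f' t) (hg : HasDerivAt g g' t) (hh : HasDerivAt h h' t) :
    HasDerivAt (fun s => ⟪L (f s) (g s), h s⟫_ℂ)
      (⟪L (f t) (g t), h'⟫_ℂ + ⟪L f' (g t) + L (f t) g', h t⟫_ℂ) t :=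
  HasDerivAt.inner ℂ ((L.hasFDerivAt.comp_hasDerivAt t hf).clm_apply hg) hh

namespace PreRepresentation

variable {E G 𝔤 H : Type*} [NormedAddCommGroup E] [NormedSpace ℝ E] [CompleteSpace E]
  [TopologicalSpace G] [ChartedSpace E G] [Group G] [LieGroup 𝓘(ℝ, E) ω G]
  [NormedAddCommGroup 𝔤] [NormedSpace ℝ 𝔤]
  [NormedAddCommGroup H] [InnerProductSpace ℂ H] [CompleteSpace H]
  {S : BanachLieSupergroup E G 𝔤} (R : PreRepresentation S H)

/-! ### Covariance of the odd operators -/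

/-- The adjoint action on the odd part. -/
def _root_.BanachLieSupergroup.adOdd (S : BanachLieSupergroup E G 𝔤) (g : G) (y : S.part 1) :
    S.part 1 := ⟨S.Ad g y, S.Ad_even g 1 y y.2⟩

theorem hasDerivAt_adOdd (x : S.part 0) (y : S.part 1) :
    HasDerivAt (fun t => S.adOdd (expCurve (S.lieIso x) t) y) (S.evenOddBracket x y) 0 := by
  refine Submodule.hasDerivAt_of_coe ?_
  have h1 := hasDerivAt_comp_expCurve (S.Ad_analytic.mdifferentiable (by simp) 1) (S.lieIso x)
  have h2 := (ContinuousLinearMap.apply ℝ 𝔤 (y : 𝔤)).hasFDerivAt.comp_hasDerivAt (0 : ℝ) h1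
  exact h2.congr_deriv (S.Ad_deriv x y)

/-- The operator `dπ(x)`, `x` even, on smooth vectors. -/
def evenAct (x : S.part 0) (v : R.Hinf) : R.Hinf :=
  ⟨R.π.orbitDeriv E (v : H) (S.lieIso x), R.π.orbitDeriv_mem_smoothVectors v.2 _⟩

theorem evenAct_mem_graph (x : S.part 0) (v : R.Hinf) :
    ((v : H), (R.evenAct x v : H)) ∈ (R.π.dOp (S.lieIso x)).graph :=
  R.π.mem_graph_dOp_orbitDeriv v.2 _

omit [CompleteSpace E] in
theorem act_one (v : R.Hinf) : R.act 1 v = v := Subtype.ext (by simp)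

omit [CompleteSpace E] in
theorem act_mul (g h : G) (v : R.Hinf) : R.act (g * h) v = R.act g (R.act h v) :=
  Subtype.ext (by simp)

omit [CompleteSpace E] in
theorem adOdd_one (y : S.part 1) : S.adOdd 1 y = y :=
  Subtype.ext (DFunLike.congr_fun (map_one S.Ad) (y : 𝔤))

omit [CompleteSpace E] in
theorem adOdd_mul (g h : G) (y : S.part 1) : S.adOdd (g * h) y = S.adOdd g (S.adOdd h y) :=
  Subtype.ext (DFunLike.congr_fun (map_mul S.Ad g h) (y : 𝔤))

/-- Smoothness supplies a derivative in `jetSpace`; its first component, which determines it, is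
`dπ(x)v`. -/
theorem hasDerivAt_jet_act (x : S.part 0) (v : R.Hinf) :
    HasDerivAt (fun t => R.jet (R.act (expCurve (S.lieIso x) t) v)) (R.jet (R.evenAct x v)) 0 := by
  have h1 := hasDerivAt_comp_expCurve ((R.contMDiff_jet_act v).mdifferentiable (by simp) 1)
    (S.lieIso x)
  refine h1.congr_deriv (R.jetSpace_ext ?_)
  have h2 : HasDerivAt (fun t => R.π.toHom (expCurve (S.lieIso x) t) (v : H))
      (mfderivOne E (fun g => R.jet (R.act g v)) (S.lieIso x)).1.1 0 :=
    ((ContinuousLinearMap.fst ℝ H (S.part 0 →L[ℝ] H)).comp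
      R.jetSpace.subtypeL).hasFDerivAt.comp_hasDerivAt (0 : ℝ) h1
  exact h2.unique (UnitaryRep.mem_graph_dOp.1 (R.evenAct_mem_graph x v))

/-- The product rule gives one term from each of `Ad`, the jet and the test vector; they cancel by
`inner_oddJet_closedOp`. -/
theorem hasDerivAt_inner_oddJet_zero (x : S.part 0) (y : S.part 1) (v : R.Hinf) {w w' : H}
    (hw : (w, w') ∈ (R.π.dOp (S.lieIso x)).graph) :
    HasDerivAt (fun t => ⟪R.oddJet (S.adOdd (expCurve (S.lieIso x) t) y)
      (R.jet (R.act (expCurve (S.lieIso x) t) v)), R.π.toHom (expCurve (S.lieIso x) t) w⟫_ℂ) 0 0 := by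
  have h2 := hasDerivAt_inner_bilinear R.oddJet (hasDerivAt_adOdd x y) (R.hasDerivAt_jet_act x v)
    (UnitaryRep.mem_graph_dOp.1 hw)
  refine h2.congr_deriv ?_
  simp only [expCurve_zero, act_one, adOdd_one, map_one,
    LinearIsometryEquiv.coe_one, id]
  rw [R.inner_oddJet_closedOp x y (k' := R.jet (R.evenAct x v)) rfl (R.closedOp_graph_of_dOp x hw),
    add_comm, add_comm (R.oddJet y _)]
  simp

theorem toHom_expCurve_mem_graph (x : S.part 0) {w w' : H} (t : ℝ)
    (hw : (w, w') ∈ (R.π.dOp (S.lieIso x)).graph) :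
    (R.π.toHom (expCurve (S.lieIso x) t) w, R.π.toHom (expCurve (S.lieIso x) t) w') ∈
      (R.π.dOp (S.lieIso x)).graph := by
  rw [UnitaryRep.mem_graph_dOp] at hw ⊢
  have h1 := ((R.π.toHom (expCurve (S.lieIso x) t)).toContinuousLinearEquiv.toContinuousLinearMap.restrictScalars
    ℝ).hasFDerivAt.comp_hasDerivAt (0 : ℝ) hw
  refine h1.congr_of_eventuallyEq (Filter.Eventually.of_forall fun s => ?_)
  have h2 : expCurve (S.lieIso x) s * expCurve (S.lieIso x) t =
      expCurve (S.lieIso x) t * expCurve (S.lieIso x) s := by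
    rw [← expCurve_add, ← expCurve_add, add_comm]
  have h3 := congrArg (fun g => R.π.toHom g w) h2
  simpa using h3

theorem toHom_expCurve_oddJet (x : S.part 0) (y : S.part 1) (v : R.Hinf) (t : ℝ) :
    R.π.toHom (expCurve (S.lieIso x) t) (R.oddJet y (R.jet v)) =
      R.oddJet (S.adOdd (expCurve (S.lieIso x) t) y) (R.jet (R.act (expCurve (S.lieIso x) t) v)) := by
  set γ := expCurve (S.lieIso x) with hγ
  have hconst : ∀ b : R.B, ⟪R.oddJet (S.adOdd (γ t) y) (R.jet (R.act (γ t) v)), R.π.toHom (γ t) b⟫_ℂ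
      = ⟪R.oddJet y (R.jet v), (b : H)⟫_ℂ := by
    intro b
    -- By the group law, the derivative at `s` is the derivative at `0` for `y`, `v` and `b` moved
    -- by `γ s`.
    have hd : ∀ s, HasDerivAt (fun s => ⟪R.oddJet (S.adOdd (γ s) y) (R.jet (R.act (γ s) v)),
        R.π.toHom (γ s) b⟫_ℂ) 0 s := by
      intro s
      have h1 := R.hasDerivAt_inner_oddJet_zero x (S.adOdd (γ s) y) (R.act (γ s) v)
        (R.toHom_expCurve_mem_graph x s (R.ρ_even x b))
      rw [← sub_self s] at h1
      refine (h1.comp_sub_const s s).congr_of_eventuallyEq (Filter.Eventually.of_forall fun r => ?_)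
      have h2 : γ r = γ (r - s) * γ s := by rw [hγ, ← expCurve_add, sub_add_cancel]
      simp only [h2, adOdd_mul, act_mul, map_mul, LinearIsometryEquiv.coe_mul, Function.comp_apply]
      rfl
    have h3 := is_const_of_deriv_eq_zero (fun s => (hd s).differentiableAt) (fun s => (hd s).deriv) t 0
    simpa [hγ, expCurve_zero, adOdd_one, act_one] using h3
  have hsymm : R.oddJet y (R.jet v) = (R.π.toHom (γ t)).symm
      (R.oddJet (S.adOdd (γ t) y) (R.jet (R.act (γ t) v))) := by
    refine R.eq_of_inner_B fun b => ?_
    rw [← hconst b, ← (R.π.toHom (γ t)).inner_map_map ((R.π.toHom (γ t)).symm _)]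
    simp
  rw [hsymm, LinearIsometryEquiv.apply_symm_apply]

/-- The group elements which are compatible with the odd operators on smooth vectors. -/
def covarianceSubgroup : Subgroup G where
  carrier := {g | ∀ (y : S.part 1) (v : R.Hinf), R.π.toHom g (R.oddJet y (R.jet v)) =
    R.oddJet (S.adOdd g y) (R.jet (R.act g v))}
  one_mem' := fun y v => by simp [adOdd_one, act_one]
  mul_mem' := fun {g h} hg hh y v => by
    rw [map_mul, LinearIsometryEquiv.coe_mul, Function.comp_apply, hh, hg, adOdd_mul, act_mul]
  inv_mem' := fun {g} hg y v => by
    have h := hg (S.adOdd g⁻¹ y) (R.act g⁻¹ v)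
    rw [← adOdd_mul, ← act_mul, mul_inv_cancel, adOdd_one, act_one] at h
    rw [← h, map_inv]
    exact (R.π.toHom g).symm_apply_apply _

omit [CompleteSpace E] in
theorem contMDiff_adOdd (hS : IsClosed (S.part 1 : Set 𝔤)) [CompleteSpace 𝔤] (y : S.part 1) :
    ContMDiff 𝓘(ℝ, E) 𝓘(ℝ, S.part 1) ∞ (fun g => S.adOdd g y) := by
  have : IsManifold 𝓘(ℝ, E) ∞ G := IsManifold.of_le (n := ω) le_top
  have : CompleteSpace (S.part 1) := hS.completeSpace_coe
  refine ContMDiff.of_linearIsometry_comp (S.part 1).subtypeₗᵢ ?_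
  exact ((ContinuousLinearMap.apply ℝ 𝔤 (y : 𝔤)).contMDiff (n := ∞)).comp
    (S.Ad_analytic.of_le le_top)

variable [CompleteSpace 𝔤]

/-- Once covariance is known, this function is the orbit map of `ρ(y)v`. -/
theorem contMDiff_oddJet_adOdd (y : S.part 1) (v : R.Hinf) :
    ContMDiff 𝓘(ℝ, E) 𝓘(ℝ, H) ∞
      (fun g => R.oddJet (S.adOdd g y) (R.jet (R.act g v))) :=
  ((R.oddJet.contMDiff (n := ∞)).comp (contMDiff_adOdd (S.isClosed_part 1) y)).clm_apply
    (R.contMDiff_jet_act v)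

theorem isClosed_covarianceSubgroup : IsClosed (R.covarianceSubgroup : Set G) := by
  have : (R.covarianceSubgroup : Set G) = ⋂ (y : S.part 1) (v : R.Hinf),
      {g | R.π.toHom g (R.oddJet y (R.jet v)) = R.oddJet (S.adOdd g y) (R.jet (R.act g v))} := by
    ext g
    simp [covarianceSubgroup]
  rw [this]
  exact isClosed_iInter fun y => isClosed_iInter fun v =>
    isClosed_eq (R.π.continuous_orbit _) (R.contMDiff_oddJet_adOdd y v).continuous

theorem mem_covarianceSubgroup (h : G) : h ∈ R.covarianceSubgroup := by
  obtain ⟨g, hg1, hB, hρ⟩ := R.conj h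
  -- Condition (vi) concerns `B` only; pairing with `b ∈ B` and moving `ρ(y)` across transfers it to
  -- smooth vectors.
  have hg : g ∈ R.covarianceSubgroup := by
    intro y v
    refine R.eq_of_inner_B fun b => ?_
    have h1 : ⟪R.π.toHom g (R.oddJet y (R.jet v)), (b : H)⟫_ℂ =
        ⟪R.oddJet y (R.jet v), (R.π.toHom g).symm (b : H)⟫_ℂ := by
      rw [← (R.π.toHom g).inner_map_map (R.oddJet y (R.jet v))]
      simp
    have h2 := R.inner_oddJet y (R.jet v) ⟨(R.π.toHom g).symm b, hB b⟩
    rw [h1, R.inner_oddJet, h2, ← (R.π.toHom g).inner_map_map, hρ y b]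
    rfl
  have hn := R.covarianceSubgroup.connectedComponent_one_subset_of_expCurve_mem
    R.isClosed_covarianceSubgroup (fun x t y v => by
      have := R.toHom_expCurve_oddJet (S.lieIso.symm x) y v t
      rwa [S.lieIso.apply_symm_apply] at this) hg1
  have : h = g * (h⁻¹ * g)⁻¹ := by group
  rw [this]
  exact R.covarianceSubgroup.mul_mem hg (R.covarianceSubgroup.inv_mem hn)

theorem oddJet_mem_smoothVectors (y : S.part 1) (v : R.Hinf) : R.oddJet y (R.jet v) ∈ R.Hinf :=
  (R.contMDiff_oddJet_adOdd y v).congr fun g => R.mem_covarianceSubgroup g y v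

end PreRepresentation

/-! ### Graphs of sums of unbounded operators -/

namespace LinearPMap

variable {K V W : Type*} [Field K] [AddCommGroup V] [Module K V] [AddCommGroup W] [Module K W]
  {f g : V →ₗ.[K] W} {v : V} {a b : W}

theorem add_mem_graph (hf : (v, a) ∈ f.graph) (hg : (v, b) ∈ g.graph) :
    (v, a + b) ∈ (f + g).graph := by
  rw [mem_graph_iff] at *
  obtain ⟨⟨_, h1⟩, rfl, rfl⟩ := hf
  obtain ⟨⟨_, h2⟩, rfl, rfl⟩ := hg
  exact ⟨⟨_, h1, h2⟩, rfl, rfl⟩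

theorem smul_mem_graph (c : K) (hf : (v, a) ∈ f.graph) : (v, c • a) ∈ (c • f).graph := by
  rw [mem_graph_iff] at *
  obtain ⟨⟨_, h1⟩, rfl, rfl⟩ := hf
  exact ⟨⟨_, h1⟩, rfl, rfl⟩

theorem mem_graph_domRestrict {p : Submodule K V} (hf : (v, a) ∈ f.graph) (hv : v ∈ p) :
    (v, a) ∈ (f.domRestrict p).graph := by
  rw [mem_graph_iff] at *
  obtain ⟨⟨_, h1⟩, rfl, rfl⟩ := hf
  exact ⟨⟨_, hv, h1⟩, rfl, domRestrict_apply rfl⟩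

end LinearPMap

namespace PreRepresentation

variable {E G 𝔤 H : Type*} [NormedAddCommGroup E] [NormedSpace ℝ E] [CompleteSpace E]
  [TopologicalSpace G] [ChartedSpace E G] [Group G] [LieGroup 𝓘(ℝ, E) ω G]
  [NormedAddCommGroup 𝔤] [NormedSpace ℝ 𝔤] [CompleteSpace 𝔤]
  [NormedAddCommGroup H] [InnerProductSpace ℂ H] [CompleteSpace H]
  {S : BanachLieSupergroup E G 𝔤} (R : PreRepresentation S H)

/-! ### The action of the complexified superalgebra on smooth vectors -/

omit [CompleteSpace 𝔤] in
theorem evenAct_mem_graph_closedOp (x : S.part 0) (v : R.Hinf) :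
    ((v : H), (R.evenAct x v : H)) ∈ (R.closedOp x).graph :=
  R.closedOp_graph_of_dOp x (R.evenAct_mem_graph x v)

/-- The even part of the representation on smooth vectors. -/
def evenLin : S.part 0 →ₗ[ℝ] R.Hinf →ₗ[ℂ] R.Hinf where
  toFun x :=
    { toFun := R.evenAct x
      map_add' := fun v w => Subtype.ext <| LinearPMap.mem_graph_snd_inj _
        (R.evenAct_mem_graph x (v + w))
        (add_mem (R.evenAct_mem_graph x v) (R.evenAct_mem_graph x w)) rfl
      map_smul' := fun c v => Subtype.ext <| LinearPMap.mem_graph_snd_inj _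
        (R.evenAct_mem_graph x (c • v))
        (Submodule.smul_mem _ c (R.evenAct_mem_graph x v)) rfl }
  map_add' x y := by
    ext v
    exact (R.jet v).1.2.map_add x y
  map_smul' c x := by
    ext v
    exact (R.jet v).1.2.map_smul c x

/-- The odd part of the representation on smooth vectors. -/
def oddLin : S.part 1 →ₗ[ℝ] R.Hinf →ₗ[ℂ] R.Hinf where
  toFun y :=
    { toFun := fun v => ⟨R.oddJet y (R.jet v), R.oddJet_mem_smoothVectors y v⟩
      map_add' := fun v w => Subtype.ext <| LinearPMap.mem_graph_snd_inj _
        (R.oddJet_mem_graph y (R.jet (v + w)))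
        (add_mem (R.oddJet_mem_graph y (R.jet v)) (R.oddJet_mem_graph y (R.jet w))) rfl
      map_smul' := fun c v => Subtype.ext <| LinearPMap.mem_graph_snd_inj _
        (R.oddJet_mem_graph y (R.jet (c • v)))
        (Submodule.smul_mem _ c (R.oddJet_mem_graph y (R.jet v))) rfl }
  map_add' y z := by
    ext v
    exact DFunLike.congr_fun (R.oddJet.map_add y z) (R.jet v)
  map_smul' c y := by
    ext v
    exact DFunLike.congr_fun (R.oddJet.map_smul c y) (R.jet v)

omit [CompleteSpace 𝔤] in
theorem coe_evenLin (x : S.part 0) (v : R.Hinf) : R.evenLin x v = R.evenAct x v := rfl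

theorem coe_oddLin (y : S.part 1) (v : R.Hinf) : (R.oddLin y v : H) = R.oddJet y (R.jet v) := rfl

/-- The representation of `𝔤` on smooth vectors. -/
def realRep : 𝔤 →ₗ[ℝ] R.Hinf →ₗ[ℂ] R.Hinf :=
  R.evenLin ∘ₗ S.evenPart + R.oddLin ∘ₗ S.oddPart

theorem realRep_even (x : S.part 0) : R.realRep x = R.evenLin x := by
  have h1 : S.evenPart (x : 𝔤) = x := Submodule.projectionOnto_apply_left S.isCompl x
  have h2 : S.oddPart (x : 𝔤) = 0 := Submodule.projectionOnto_apply_right S.isCompl.symm x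
  simp [realRep, h1, h2]

theorem realRep_odd (y : S.part 1) : R.realRep y = R.oddLin y := by
  have h1 : S.evenPart (y : 𝔤) = 0 := Submodule.projectionOnto_apply_right S.isCompl y
  have h2 : S.oddPart (y : 𝔤) = y := Submodule.projectionOnto_apply_left S.isCompl.symm y
  simp [realRep, h1, h2]

/-- The factor relating the operator of a homogeneous element with its adjoint. -/
def adjointFactor (i : ZMod 2) : ℂ := if i = 0 then -1 else -Complex.I

theorem _root_.ZMod.eq_zero_or_one (i : ZMod 2) : i = 0 ∨ i = 1 := by
  revert i
  decide

/-- Passing to adjoints reverses products, so a supercommutator returns to itself up to `-(-1)^{ij}`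
and the two factors. This compatibility is what lets `realRep_bracket` be tested on `B`. -/
theorem adjointFactor_add (i j : ZMod 2) :
    adjointFactor (i + j) =
      -((-1 : ℂ) ^ (i.val * j.val) * (adjointFactor i * adjointFactor j)) := by
  have h0 : (0 : ZMod 2).val = 0 := rfl
  have h1 : (1 : ZMod 2).val = 1 := rfl
  have h2 : (1 + 1 : ZMod 2) = 0 := rfl
  rcases ZMod.eq_zero_or_one i with rfl | rfl <;> rcases ZMod.eq_zero_or_one j with rfl | rfl <;>
    simp [adjointFactor, h0, h1, h2]

theorem inner_realRep (i : ZMod 2) {x : 𝔤} (hx : x ∈ S.part i) (v : R.Hinf) (b : R.B) :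
    ⟪(R.realRep x v : H), (b : H)⟫_ℂ = adjointFactor i * ⟪(v : H), (R.ρ x b : H)⟫_ℂ := by
  rcases ZMod.eq_zero_or_one i with rfl | rfl
  · lift x to S.part 0 using hx
    rw [realRep_even]
    simpa [adjointFactor, coe_evenLin] using
      R.inner_closedOp_even x (R.evenAct_mem_graph_closedOp x v) (R.mem_graph_closedOp x b)
  · lift x to S.part 1 using hx
    rw [realRep_odd]
    simpa [adjointFactor, coe_oddLin] using R.inner_oddJet x (R.jet v) b

theorem realRep_bracket (i j : ZMod 2) {x y : 𝔤} (hx : x ∈ S.part i) (hy : y ∈ S.part j)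
    (v : R.Hinf) : R.realRep (S.bracket x y) v =
      R.realRep x (R.realRep y v) - (-1 : ℂ) ^ (i.val * j.val) • R.realRep y (R.realRep x v) := by
  refine Subtype.ext (R.eq_of_inner_B fun b => ?_)
  have hs : (starRingEnd ℂ) ((-1 : ℂ) ^ (i.val * j.val)) = (-1 : ℂ) ^ (i.val * j.val) := by simp
  have hs2 : (-1 : ℂ) ^ (i.val * j.val) * (-1 : ℂ) ^ (i.val * j.val) = 1 := by
    rw [← mul_pow]; simp
  rw [R.inner_realRep (i + j) (S.bracket_mem i j x hx y hy), R.ρ_bracket i j x hx y hy,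
    Submodule.coe_sub, Submodule.coe_sub, inner_sub_left, inner_sub_right, Submodule.coe_smul,
    Submodule.coe_smul, inner_smul_left, inner_smul_right, R.inner_realRep i hx,
    R.inner_realRep j hy, R.inner_realRep j hy, R.inner_realRep i hx, adjointFactor_add, hs]
  linear_combination adjointFactor i * adjointFactor j * ⟪(v : H), R.ρ y (R.ρ x b)⟫_ℂ * hs2

/-- The representation of the complexification of `𝔤` on smooth vectors. -/
def smoothRep : (ℂ ⊗[ℝ] 𝔤) →ₗ[ℂ] R.Hinf →ₗ[ℂ] R.Hinf := R.realRep.liftBaseChange ℂ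

theorem smoothRep_tmul (ζ : ℂ) (x : 𝔤) : R.smoothRep (ζ ⊗ₜ[ℝ] x) = ζ • R.realRep x :=
  LinearMap.liftBaseChange_tmul ..

omit [CompleteSpace 𝔤] in
theorem _root_.tmul_tensorRe_add_tmul_tensorIm (z : ℂ ⊗[ℝ] 𝔤) :
    (1 : ℂ) ⊗ₜ[ℝ] tensorRe z + Complex.I ⊗ₜ[ℝ] tensorIm z = z := by
  induction z with
  | zero => simp
  | add a b ha hb =>
    rw [map_add, map_add, TensorProduct.tmul_add, TensorProduct.tmul_add]
    nth_rewrite 3 [← ha]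
    nth_rewrite 3 [← hb]
    abel
  | tmul ζ x =>
    have h1 : tensorRe (ζ ⊗ₜ[ℝ] x) = ζ.re • x := by simp [tensorRe]
    have h2 : tensorIm (ζ ⊗ₜ[ℝ] x) = ζ.im • x := by simp [tensorIm]
    rw [h1, h2, TensorProduct.tmul_smul, TensorProduct.tmul_smul, TensorProduct.smul_tmul',
      TensorProduct.smul_tmul', ← TensorProduct.add_tmul]
    congr 1
    apply Complex.ext <;> simp

theorem smoothRep_apply (z : ℂ ⊗[ℝ] 𝔤) (v : R.Hinf) :
    R.smoothRep z v = R.realRep (tensorRe z) v + Complex.I • R.realRep (tensorIm z) v := by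
  conv_lhs => rw [← tmul_tensorRe_add_tmul_tensorIm z]
  simp [smoothRep_tmul]

theorem smoothRep_mem_graph (z : ℂ ⊗[ℝ] 𝔤) (v : R.Hinf) :
    ((v : H), (R.smoothRep z v : H)) ∈ (R.tilde z).graph := by
  have h := LinearPMap.add_mem_graph (LinearPMap.add_mem_graph (LinearPMap.add_mem_graph
    (R.evenAct_mem_graph_closedOp (S.evenPart (tensorRe z)) v)
    (LinearPMap.smul_mem_graph Complex.I
      (R.evenAct_mem_graph_closedOp (S.evenPart (tensorIm z)) v)))
    (R.oddJet_mem_graph (S.oddPart (tensorRe z)) (R.jet v)))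
    (LinearPMap.smul_mem_graph Complex.I
      (R.oddJet_mem_graph (S.oddPart (tensorIm z)) (R.jet v)))
  have h2 := LinearPMap.mem_graph_domRestrict h v.2
  have h3 : (R.smoothRep z v : H) = R.evenAct (S.evenPart (tensorRe z)) v +
      Complex.I • (R.evenAct (S.evenPart (tensorIm z)) v : H) +
      R.oddJet (S.oddPart (tensorRe z)) (R.jet v) +
      Complex.I • R.oddJet (S.oddPart (tensorIm z)) (R.jet v) := by
    rw [smoothRep_apply]
    simp only [realRep, LinearMap.add_apply, LinearMap.comp_apply, smul_add, Submodule.coe_add,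
      Submodule.coe_smul, coe_evenLin, coe_oddLin]
    abel
  rw [h3]
  exact h2

theorem smoothRep_bracketC (i j : ZMod 2) {x y : ℂ ⊗[ℝ] 𝔤} (hx : x ∈ S.partC i)
    (hy : y ∈ S.partC j) (v : R.Hinf) : R.smoothRep (S.bracketC x y) v =
      R.smoothRep x (R.smoothRep y v) -
        (-1 : ℂ) ^ (i.val * j.val) • R.smoothRep y (R.smoothRep x v) := by
  rw [BanachLieSuperalgebra.partC, Submodule.baseChange_eq_span] at hx hy
  induction hx using Submodule.span_induction with
  | zero => simp
  | add a b _ _ ha hb =>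
    simp only [map_add, LinearMap.add_apply, ha, hb, smul_add]
    abel
  | smul c a _ ha =>
    simp only [map_smul, LinearMap.smul_apply, ha, smul_sub, smul_comm c]
  | mem a ha =>
    obtain ⟨a, ha', rfl⟩ := ha
    induction hy using Submodule.span_induction with
    | zero => simp
    | add b c _ _ hb hc =>
      simp only [map_add, LinearMap.add_apply, hb, hc, smul_add]
      abel
    | smul c b _ hb =>
      simp only [map_smul, LinearMap.smul_apply, hb, smul_sub, smul_comm c]
    | mem b hb =>
      obtain ⟨b, hb', rfl⟩ := hb
      simp [BanachLieSuperalgebra.bracketC, smoothRep_tmul, R.realRep_bracket i j ha' hb']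

end PreRepresentation

/-! ### Pascal's rule for binomial sums -/

theorem sum_choose_succ_mul (n : ℕ) (a : ℕ → ℝ) :
    ∑ k ∈ Finset.range (n + 2), ((n + 1).choose k : ℝ) * a k =
      ∑ k ∈ Finset.range (n + 1), (n.choose k : ℝ) * a k +
        ∑ k ∈ Finset.range (n + 1), (n.choose k : ℝ) * a (k + 1) := by
  have h1 : ∑ k ∈ Finset.range (n + 1), (n.choose k : ℝ) * a k =
      ∑ k ∈ Finset.range (n + 1), (n.choose (k + 1) : ℝ) * a (k + 1) + a 0 := by
    have h2 := Finset.sum_range_succ (fun k => (n.choose k : ℝ) * a k) (n + 1)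
    rw [Finset.sum_range_succ', Nat.choose_succ_self] at h2
    simpa using h2.symm
  rw [Finset.sum_range_succ', h1]
  simp only [Nat.choose_succ_succ, Nat.cast_add, add_mul, Finset.sum_add_distrib]
  simp
  ring

namespace PreRepresentation

variable {E G 𝔤 H : Type*} [NormedAddCommGroup E] [NormedSpace ℝ E] [CompleteSpace E]
  [TopologicalSpace G] [ChartedSpace E G] [Group G] [LieGroup 𝓘(ℝ, E) ω G]
  [NormedAddCommGroup 𝔤] [NormedSpace ℝ 𝔤]
  [NormedAddCommGroup H] [InnerProductSpace ℂ H] [CompleteSpace H]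
  {S : BanachLieSupergroup E G 𝔤} (R : PreRepresentation S H)

/-! ### The seminorms -/

/-- The operator `dπ(x₁) ⋯ dπ(xₙ)` on smooth vectors. -/
def iterAct (xs : List (S.part 0)) : R.Hinf →ₗ[ℂ] R.Hinf := (xs.map R.evenLin).prod

@[simp] theorem iterAct_nil (v : R.Hinf) : R.iterAct [] v = v := rfl

@[simp] theorem iterAct_cons (x : S.part 0) (xs : List (S.part 0)) (v : R.Hinf) :
    R.iterAct (x :: xs) v = R.evenLin x (R.iterAct xs v) := by
  simp [iterAct]

theorem iterAct_append (xs : List (S.part 0)) (x : S.part 0) (v : R.Hinf) :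
    R.iterAct (xs ++ [x]) v = R.iterAct xs (R.evenLin x v) := by
  simp [iterAct]

theorem iteratedEq_iff (xs : List (S.part 0)) (v : R.Hinf) (w : H) :
    R.π.IteratedEq S xs v w ↔ w = R.iterAct xs v := by
  induction xs generalizing w with
  | nil => exact eq_comm
  | cons x xs ih =>
    rw [iterAct_cons]
    constructor
    · rintro ⟨u, hu, hw⟩
      rw [(ih u).1 hu] at hw
      exact LinearPMap.mem_graph_snd_inj _ hw (R.evenAct_mem_graph x _) rfl
    · rintro rfl
      exact ⟨_, (ih _).2 rfl, R.evenAct_mem_graph x _⟩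

theorem q_le_iff (n : ℕ) (v : R.Hinf) (C : ℝ≥0∞) :
    R.π.q S n v ≤ C ↔ ∀ xs : List (S.part 0), xs.length = n → (∀ x ∈ xs, ‖x‖ ≤ 1) →
      ‖(R.iterAct xs v : H)‖ₑ ≤ C := by
  simp only [UnitaryRep.q, iSup_le_iff, iteratedEq_iff]
  constructor
  · exact fun h xs hn hxs => h xs _ hn hxs rfl
  · rintro h xs w hn hxs rfl
    exact h xs hn hxs

/-- Closed graph theorem: the closure of `ρ(z)` has closed graph and extends `dπ(z)`. -/
theorem continuous_coe_evenLin_comp {V : Type*} [NormedAddCommGroup V] [NormedSpace ℝ V]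
    [CompleteSpace V] (z : S.part 0) {M : V →ₗ[ℝ] R.Hinf} (hM : Continuous fun x => (M x : H)) :
    Continuous fun x => (R.evenLin z (M x) : H) := by
  let N : V →ₗ[ℝ] H :=
    (R.Hinf.subtype.restrictScalars ℝ) ∘ₗ ((R.evenLin z).restrictScalars ℝ) ∘ₗ M
  refine N.continuous_of_seq_closed_graph fun u x y hu hy => ?_
  have h1 : (((M x : R.Hinf) : H), y) ∈ (R.closedOp z).graph :=
    (R.isClosed_graph_closedOp_even z).mem_of_tendsto
      (((hM.tendsto x).comp hu).prodMk_nhds hy)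
      (Filter.Eventually.of_forall fun n => R.evenAct_mem_graph_closedOp z (M (u n)))
  exact LinearPMap.mem_graph_snd_inj _ h1 (R.evenAct_mem_graph_closedOp z (M x)) rfl

theorem continuous_coe_evenLin (v : R.Hinf) : Continuous fun x => (R.evenLin x v : H) :=
  (R.jet v).1.2.continuous

variable [CompleteSpace 𝔤]

theorem continuous_coe_iterAct_evenLin (xs : List (S.part 0)) (v : R.Hinf) :
    Continuous fun x => (R.iterAct xs (R.evenLin x v) : H) := by
  have : CompleteSpace (S.part 0) := (S.isClosed_part 0).completeSpace_coe
  induction xs with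
  | nil => exact R.continuous_coe_evenLin v
  | cons z xs ih =>
    simp only [iterAct_cons]
    exact R.continuous_coe_evenLin_comp z
      (M := ((R.iterAct xs).restrictScalars ℝ) ∘ₗ ((LinearMap.applyₗ v).restrictScalars ℝ ∘ₗ R.evenLin)) ih

/-- Induction by uniform boundedness, with the rightmost factor as the variable: the maps `x ↦
dπ(x₁)⋯dπ(xₙ)dπ(x)v`, `‖xᵢ‖ ≤ 1`, are pointwise bounded by the hypothesis for `dπ(x)v`. -/
theorem exists_norm_iterAct_le (n : ℕ) (v : R.Hinf) :
    ∃ C : ℝ, ∀ xs : List (S.part 0), xs.length = n → (∀ x ∈ xs, ‖x‖ ≤ 1) →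
      ‖(R.iterAct xs v : H)‖ ≤ C := by
  have : CompleteSpace (S.part 0) := (S.isClosed_part 0).completeSpace_coe
  induction n generalizing v with
  | zero =>
    refine ⟨‖(v : H)‖, fun xs hxs _ => ?_⟩
    rw [List.length_eq_zero_iff.1 hxs]
    rfl
  | succ n ih =>
    let L : {xs : List (S.part 0) // xs.length = n ∧ ∀ x ∈ xs, ‖x‖ ≤ 1} → S.part 0 →L[ℝ] H :=
      fun xs => ⟨(R.Hinf.subtype.restrictScalars ℝ) ∘ₗ ((R.iterAct xs.1).restrictScalars ℝ) ∘ₗ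
        ((LinearMap.applyₗ v).restrictScalars ℝ ∘ₗ R.evenLin),
        R.continuous_coe_iterAct_evenLin xs.1 v⟩
    obtain ⟨C, hC⟩ := banach_steinhaus (g := L) fun x => by
      obtain ⟨C, hC⟩ := ih (R.evenLin x v)
      exact ⟨C, fun xs => hC xs.1 xs.2.1 xs.2.2⟩
    refine ⟨C, fun xs hn hxs => ?_⟩
    rcases List.eq_nil_or_concat xs with rfl | ⟨ys, x, rfl⟩
    · simp at hn
    · rw [List.concat_eq_append] at hn hxs ⊢
      rw [iterAct_append]
      have h1 := (L ⟨ys, by simpa using hn, fun y hy => hxs y (by simp [hy])⟩).le_opNorm x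
      have h2 := hC ⟨ys, by simpa using hn, fun y hy => hxs y (by simp [hy])⟩
      have h3 : ‖x‖ ≤ 1 := hxs x (by simp)
      refine h1.trans ?_
      nlinarith [norm_nonneg x, norm_nonneg (L ⟨ys, by simpa using hn, fun y hy => hxs y (by simp [hy])⟩)]

theorem q_ne_top (n : ℕ) (v : R.Hinf) : R.π.q S n v ≠ ⊤ := by
  obtain ⟨C, hC⟩ := R.exists_norm_iterAct_le n v
  refine ne_top_of_le_ne_top (ENNReal.ofReal_ne_top (r := C)) ((R.q_le_iff n v _).2 ?_)
  intro xs hn hxs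
  rw [← ofReal_norm]
  exact ENNReal.ofReal_le_ofReal (hC xs hn hxs)

/-- The seminorm `q_n` with real values. -/
def smoothNorm (n : ℕ) (v : R.Hinf) : ℝ := (R.π.q S n v).toReal

theorem ofReal_smoothNorm (n : ℕ) (v : R.Hinf) :
    ENNReal.ofReal (R.smoothNorm n v) = R.π.q S n v :=
  ENNReal.ofReal_toReal (R.q_ne_top n v)

omit [CompleteSpace E] [CompleteSpace 𝔤] in
theorem smoothNorm_nonneg (n : ℕ) (v : R.Hinf) : 0 ≤ R.smoothNorm n v := ENNReal.toReal_nonneg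

theorem norm_iterAct_le (v : R.Hinf) {xs : List (S.part 0)} (hxs : ∀ x ∈ xs, ‖x‖ ≤ 1) :
    ‖(R.iterAct xs v : H)‖ ≤ R.smoothNorm xs.length v := by
  have h := (R.q_le_iff xs.length v _).1 le_rfl xs rfl hxs
  rw [← ofReal_smoothNorm, ← ofReal_norm] at h
  exact (ENNReal.ofReal_le_ofReal_iff (R.smoothNorm_nonneg _ v)).1 h

omit [CompleteSpace 𝔤] in
theorem smoothNorm_le {n : ℕ} {v : R.Hinf} {C : ℝ}
    (h : ∀ xs : List (S.part 0), xs.length = n → (∀ x ∈ xs, ‖x‖ ≤ 1) →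
      ‖(R.iterAct xs v : H)‖ ≤ C) : R.smoothNorm n v ≤ C := by
  -- The list of `n` zeros is admissible and forces `C` to be nonnegative.
  have hC : 0 ≤ C := (norm_nonneg _).trans (h (List.replicate n 0) (by simp) fun x hx => by
    simp [List.eq_of_mem_replicate hx])
  refine ENNReal.toReal_le_of_le_ofReal hC ((R.q_le_iff n v _).2 fun xs hn hxs => ?_)
  rw [← ofReal_norm]
  exact ENNReal.ofReal_le_ofReal (h xs hn hxs)

theorem smoothNorm_zero_eq (v : R.Hinf) : R.smoothNorm 0 v = ‖(v : H)‖ := by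
  refine le_antisymm (R.smoothNorm_le fun xs hn _ => ?_) (R.norm_iterAct_le v (xs := []) (by simp))
  rw [List.length_eq_zero_iff.1 hn]
  rfl

theorem smoothNorm_add_le (n : ℕ) (v w : R.Hinf) :
    R.smoothNorm n (v + w) ≤ R.smoothNorm n v + R.smoothNorm n w := by
  refine R.smoothNorm_le ?_
  rintro xs rfl hxs
  rw [map_add, Submodule.coe_add]
  exact (norm_add_le _ _).trans (add_le_add (R.norm_iterAct_le v hxs) (R.norm_iterAct_le w hxs))

theorem smoothNorm_smul_le (n : ℕ) (c : ℂ) (v : R.Hinf) :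
    R.smoothNorm n (c • v) ≤ ‖c‖ * R.smoothNorm n v := by
  refine R.smoothNorm_le ?_
  rintro xs rfl hxs
  rw [map_smul, Submodule.coe_smul, norm_smul]
  gcongr
  exact R.norm_iterAct_le v hxs

theorem smoothNorm_evenLin_le (n : ℕ) (x : S.part 0) (v : R.Hinf) :
    R.smoothNorm n (R.evenLin x v) ≤ ‖x‖ * R.smoothNorm (n + 1) v := by
  refine R.smoothNorm_le ?_
  rintro xs rfl hxs
  rcases eq_or_ne x 0 with rfl | hx
  · simp
  have hx0 : ‖x‖ ≠ 0 := norm_ne_zero_iff.2 hx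
  have h1 : x = ‖x‖ • (‖x‖⁻¹ • x) := by rw [smul_smul, mul_inv_cancel₀ hx0, one_smul]
  have h2 : R.iterAct xs (R.evenLin x v) =
      ((‖x‖ : ℝ) : ℂ) • R.iterAct (xs ++ [‖x‖⁻¹ • x]) v := by
    rw [iterAct_append, ← map_smul, Complex.coe_smul]
    conv_lhs => rw [h1]
    rw [map_smul R.evenLin, LinearMap.smul_apply]
  have h3 := R.norm_iterAct_le v (xs := xs ++ [‖x‖⁻¹ • x]) (by
    intro z hz
    rcases List.mem_append.1 hz with h | h
    · exact hxs z h
    · rw [List.mem_singleton.1 h, norm_smul, norm_inv, norm_norm, inv_mul_cancel₀ hx0])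
  rw [h2, Submodule.coe_smul, norm_smul, Complex.norm_real, norm_norm]
  rw [List.length_append] at h3
  gcongr
  exact h3

theorem smoothNorm_succ_le {n : ℕ} {v : R.Hinf} {C : ℝ}
    (h : ∀ x : S.part 0, ‖x‖ ≤ 1 → R.smoothNorm n (R.evenLin x v) ≤ C) :
    R.smoothNorm (n + 1) v ≤ C := by
  refine R.smoothNorm_le fun xs hn hxs => ?_
  rcases List.eq_nil_or_concat xs with rfl | ⟨ys, x, rfl⟩
  · simp at hn
  · rw [List.concat_eq_append] at hn hxs ⊢
    rw [iterAct_append]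
    have h1 := R.norm_iterAct_le (R.evenLin x v) (xs := ys) fun y hy => hxs y (by simp [hy])
    have h2 : ys.length = n := by simpa using hn
    rw [h2] at h1
    exact h1.trans (h x (hxs x (by simp)))

theorem evenLin_oddLin (x : S.part 0) (y : S.part 1) (v : R.Hinf) :
    R.evenLin x (R.oddLin y v) =
      R.oddLin (S.evenOddBracket x y) v + R.oddLin y (R.evenLin x v) := by
  have h := R.realRep_bracket 0 1 x.2 y.2 v
  have h2 : S.bracket x y = (S.evenOddBracket x y : 𝔤) := rfl
  rw [h2, realRep_even, realRep_odd, realRep_odd] at h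
  rw [h]
  simp

/-- The estimate of the odd operators with respect to the seminorms `q_n`. -/
theorem smoothNorm_oddLin_le (n : ℕ) (y : S.part 1) (v : R.Hinf) :
    R.smoothNorm n (R.oddLin y v) ≤ 1 / (2 * √2) * ‖y‖ *
      ∑ k ∈ Finset.range (n + 2), ((n + 1).choose k : ℝ) * R.smoothNorm k v := by
  have hc : (0 : ℝ) ≤ 1 / (2 * √2) := by positivity
  induction n generalizing y v with
  | zero =>
    rw [smoothNorm_zero_eq]
    have h1 := R.norm_sq_oddJet_le y (R.jet v)
    have h2 : ‖(R.jet v).1.2 (S.oddBracket y y)‖ ≤ ‖y‖ * ‖y‖ * R.smoothNorm 1 v := by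
      have h3 := R.smoothNorm_evenLin_le 0 (S.oddBracket y y) v
      rw [smoothNorm_zero_eq] at h3
      exact h3.trans (mul_le_mul_of_nonneg_right (norm_oddBracket_le y) (R.smoothNorm_nonneg 1 v))
    have h4 : ‖(R.jet v).1.1‖ = R.smoothNorm 0 v := (R.smoothNorm_zero_eq v).symm
    rw [h4] at h1
    have ha := R.smoothNorm_nonneg 0 v
    have hb := R.smoothNorm_nonneg 1 v
    have h5 : ‖(R.oddLin y v : H)‖ ^ 2 ≤
        1 / 2 * (R.smoothNorm 0 v * (‖y‖ * ‖y‖ * R.smoothNorm 1 v)) :=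
      h1.trans (by gcongr)
    have h6 : ∑ k ∈ Finset.range (0 + 2), ((0 + 1).choose k : ℝ) * R.smoothNorm k v =
        R.smoothNorm 0 v + R.smoothNorm 1 v := by
      simp [Finset.sum_range_succ]
    rw [h6]
    refine le_of_sq_le_sq ?_ (by positivity)
    -- The constant is chosen so that the bound `½ab ≤ (a + b)² / 8`, with `a = q₀(v)` and `b =
    -- q₁(v)`, becomes linear after taking roots.
    have h7 : (1 / (2 * √2)) ^ 2 = (1 : ℝ) / 8 := by
      rw [div_pow, mul_pow, Real.sq_sqrt (by norm_num)]
      norm_num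
    rw [mul_pow, mul_pow, h7]
    nlinarith [mul_nonneg (sq_nonneg ‖y‖) (sq_nonneg (R.smoothNorm 0 v - R.smoothNorm 1 v))]
  | succ n ih =>
    refine R.smoothNorm_succ_le fun x hx => ?_
    rw [evenLin_oddLin]
    refine (R.smoothNorm_add_le n _ _).trans ?_
    refine (add_le_add (ih _ v) (ih y _)).trans ?_
    -- The commutator term yields the `q_k(v)` and the other term the `q_{k+1}(v)`; Pascal's rule
    -- joins the two sums.
    rw [sum_choose_succ_mul (n + 1), mul_add]
    have h1 : ‖S.evenOddBracket x y‖ ≤ ‖y‖ := (norm_evenOddBracket_le x y).trans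
      (mul_le_of_le_one_left (norm_nonneg y) hx)
    have h2 : ∀ k, R.smoothNorm k (R.evenLin x v) ≤ R.smoothNorm (k + 1) v := fun k =>
      (R.smoothNorm_evenLin_le k x v).trans
        (mul_le_of_le_one_left (R.smoothNorm_nonneg _ v) hx)
    have h3 : 0 ≤ ∑ k ∈ Finset.range (n + 2), ((n + 1).choose k : ℝ) * R.smoothNorm k v :=
      Finset.sum_nonneg fun k _ => mul_nonneg (Nat.cast_nonneg _) (R.smoothNorm_nonneg k v)
    gcongr
    exact h2 _

theorem q_oddLin_le (n : ℕ) (y : S.part 1) (v : R.Hinf) :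
    R.π.q S n (R.oddLin y v) ≤ ENNReal.ofReal (1 / (2 * √2) * ‖y‖) *
      ∑ k ∈ Finset.range (n + 2), ((n + 1).choose k : ℝ≥0∞) * R.π.q S k v := by
  have h := ENNReal.ofReal_le_ofReal (R.smoothNorm_oddLin_le n y v)
  rw [ENNReal.ofReal_mul (by positivity), ENNReal.ofReal_sum_of_nonneg fun k _ =>
    mul_nonneg (Nat.cast_nonneg _) (R.smoothNorm_nonneg k v), ofReal_smoothNorm] at h
  simpa only [ENNReal.ofReal_mul (Nat.cast_nonneg _), ENNReal.ofReal_natCast,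
    ofReal_smoothNorm] using h

end PreRepresentation

/-! ### Continuity of biadditive maps -/

/-- A biadditive map is jointly continuous if it is bounded with respect to the seminorms. -/
theorem continuous_gaugeTopology_of_le {X Y Z ι κ l : Type*} [AddCommGroup X] [AddCommGroup Y]
    [AddCommGroup Z] {p : ι → X → ℝ≥0∞} {q : κ → Y → ℝ≥0∞} {r : l → Z → ℝ≥0∞}
    (hp : ∀ i x, p i x ≠ ⊤) (hp0 : ∀ i, p i 0 = 0) (hq : ∀ k y, q k y ≠ ⊤) (hq0 : ∀ k, q k 0 = 0)
    (hr : ∀ m z w, r m (z + w) ≤ r m z + r m w) (f : X →+ Y →+ Z)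
    (hf : ∀ m, ∃ (i : ι) (s : Finset κ) (C : ℝ≥0∞), C ≠ ⊤ ∧
      ∀ x y, r m (f x y) ≤ C * p i x * ∑ k ∈ s, q k y) :
    @Continuous _ _ (@instTopologicalSpaceProd _ _ (gaugeTopology p) (gaugeTopology q))
      (gaugeTopology r) (fun z : X × Y => f z.1 z.2) := by
  let _ : TopologicalSpace X := gaugeTopology p
  let _ : TopologicalSpace Y := gaugeTopology q
  refine continuous_generateFrom_iff.2 ?_
  rintro _ ⟨m, z₀, ε, hε, rfl⟩
  rw [isOpen_iff_mem_nhds]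
  rintro ⟨x₀, y₀⟩ h₀
  obtain ⟨i, s, C, hC, hf⟩ := hf m
  change r m (f x₀ y₀ - z₀) < ε at h₀
  set Q := ∑ k ∈ s, q k y₀ with hQ
  have hQt : Q ≠ ⊤ := ENNReal.sum_ne_top.2 fun k _ => hq k y₀
  -- If the increments are at most `η ≤ 1` in the relevant seminorms, the three cross terms in
  -- `hsplit` add up to at most `η * A`.
  set A : ℝ≥0∞ := C * (s.card + Q + p i x₀ * s.card) with hA
  have hAt : A ≠ ⊤ := ENNReal.mul_ne_top hC (ENNReal.add_ne_top.2
    ⟨ENNReal.add_ne_top.2 ⟨ENNReal.natCast_ne_top _, hQt⟩,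
      ENNReal.mul_ne_top (hp i x₀) (ENNReal.natCast_ne_top _)⟩)
  obtain ⟨η₀, hη₀, hη₀A⟩ := ENNReal.exists_nnreal_pos_mul_lt hAt (tsub_pos_of_lt h₀).ne'
  set η : ℝ≥0∞ := min η₀ 1 with hη
  have hη0 : 0 < η := lt_min (by exact_mod_cast hη₀) one_pos
  have hη1 : η ≤ 1 := min_le_right _ _
  have hηA : η * A < ε - r m (f x₀ y₀ - z₀) :=
    (mul_le_mul_left (min_le_left _ _) A).trans_lt hη₀A
  have hU : {x | p i (x - x₀) < η} ∈ 𝓝 x₀ :=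
    IsOpen.mem_nhds (TopologicalSpace.isOpen_generateFrom_of_mem
      (show _ ∈ {U | ∃ j a ε, 0 < ε ∧ U = {x | p j (x - a) < ε}} from ⟨i, x₀, η, hη0, rfl⟩))
      (by simpa [hp0] using hη0)
  have hV : (⋂ k ∈ s, {y | q k (y - y₀) < η}) ∈ 𝓝 y₀ :=
    (Filter.biInter_finset_mem s).2 fun k _ =>
      IsOpen.mem_nhds (TopologicalSpace.isOpen_generateFrom_of_mem
        (show _ ∈ {U | ∃ j a ε, 0 < ε ∧ U = {y | q j (y - a) < ε}} from ⟨k, y₀, η, hη0, rfl⟩))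
        (by simpa [hq0] using hη0)
  filter_upwards [prod_mem_nhds hU hV]
  rintro ⟨x, y⟩ ⟨hx, hy⟩
  change r m (f x y - z₀) < ε
  have hx' : p i (x - x₀) ≤ η := le_of_lt hx
  have hy' : ∑ k ∈ s, q k (y - y₀) ≤ s.card * η := by
    rw [← nsmul_eq_mul]
    refine Finset.sum_le_card_nsmul s _ _ fun k hk => ?_
    exact le_of_lt (Set.mem_iInter₂.1 hy k hk)
  have hsplit : f x y - z₀ = (f x₀ y₀ - z₀) +
      (f (x - x₀) (y - y₀) + f (x - x₀) y₀ + f x₀ (y - y₀)) := by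
    simp only [map_sub, AddMonoidHom.sub_apply]
    abel
  have hbound : r m (f (x - x₀) (y - y₀) + f (x - x₀) y₀ + f x₀ (y - y₀)) ≤ η * A := by
    refine (hr m _ _).trans ((add_le_add_left (hr m _ _) _).trans ?_)
    refine (add_le_add (add_le_add (hf _ _) (hf _ _)) (hf _ _)).trans ?_
    have e1 : C * p i (x - x₀) * ∑ k ∈ s, q k (y - y₀) ≤ η * (C * s.card) := by
      calc C * p i (x - x₀) * ∑ k ∈ s, q k (y - y₀) ≤ C * 1 * (s.card * η) := by
            gcongr
            exact hx'.trans hη1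
        _ = η * (C * s.card) := by ring
    have e2 : C * p i (x - x₀) * ∑ k ∈ s, q k y₀ ≤ η * (C * Q) := by
      calc C * p i (x - x₀) * ∑ k ∈ s, q k y₀ ≤ C * η * Q := by gcongr
        _ = η * (C * Q) := by ring
    have e3 : C * p i x₀ * ∑ k ∈ s, q k (y - y₀) ≤ η * (C * (p i x₀ * s.card)) := by
      calc C * p i x₀ * ∑ k ∈ s, q k (y - y₀) ≤ C * p i x₀ * (s.card * η) := by gcongr
        _ = η * (C * (p i x₀ * s.card)) := by ring
    refine (add_le_add (add_le_add e1 e2) e3).trans (le_of_eq ?_)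
    rw [hA]
    ring
  rw [hsplit]
  refine (hr m _ _).trans_lt ?_
  exact lt_tsub_iff_left.1 (hbound.trans_lt hηA)

/-! ### The norm of the complexification -/

section Complexification

variable {V : Type*} [NormedAddCommGroup V] [NormedSpace ℝ V]

theorem enorm_tensorRe_le (z : ℂ ⊗[ℝ] V) : ‖tensorRe z‖ₑ ≤ complexificationNorm z := by
  refine le_iInf fun k => le_iInf fun ζ => le_iInf fun x => le_iInf fun hz => ?_
  rw [hz, map_sum]
  refine (enorm_sum_le _ _).trans (Finset.sum_le_sum fun i _ => ?_)
  have h : tensorRe (ζ i ⊗ₜ[ℝ] x i) = (ζ i).re • x i := by simp [tensorRe]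
  rw [h, enorm_smul]
  gcongr
  rw [← ofReal_norm, ← ofReal_norm]
  exact ENNReal.ofReal_le_ofReal (Complex.abs_re_le_norm _)

theorem enorm_tensorIm_le (z : ℂ ⊗[ℝ] V) : ‖tensorIm z‖ₑ ≤ complexificationNorm z := by
  refine le_iInf fun k => le_iInf fun ζ => le_iInf fun x => le_iInf fun hz => ?_
  rw [hz, map_sum]
  refine (enorm_sum_le _ _).trans (Finset.sum_le_sum fun i _ => ?_)
  have h : tensorIm (ζ i ⊗ₜ[ℝ] x i) = (ζ i).im • x i := by simp [tensorIm]
  rw [h, enorm_smul]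
  gcongr
  rw [← ofReal_norm, ← ofReal_norm]
  exact ENNReal.ofReal_le_ofReal (Complex.abs_im_le_norm _)

theorem complexificationNorm_ne_top (z : ℂ ⊗[ℝ] V) : complexificationNorm z ≠ ⊤ := by
  have hz : z = ∑ i : Fin 2, (![1, Complex.I] i) ⊗ₜ[ℝ] (![tensorRe z, tensorIm z] i) := by
    simp [Fin.sum_univ_two, tmul_tensorRe_add_tmul_tensorIm]
  refine ne_top_of_le_ne_top ?_ (iInf_le_of_le 2 (iInf_le_of_le _ (iInf_le_of_le _
    (iInf_le_of_le hz le_rfl))))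
  simp [Fin.sum_univ_two, ENNReal.mul_eq_top]

theorem complexificationNorm_zero : complexificationNorm (0 : ℂ ⊗[ℝ] V) = 0 := by
  refine le_antisymm (iInf_le_of_le 0 (iInf_le_of_le 0 (iInf_le_of_le 0
    (iInf_le_of_le (by simp) (by simp))))) bot_le

end Complexification

namespace PreRepresentation

variable {E G 𝔤 H : Type*} [NormedAddCommGroup E] [NormedSpace ℝ E] [CompleteSpace E]
  [TopologicalSpace G] [ChartedSpace E G] [Group G] [LieGroup 𝓘(ℝ, E) ω G]
  [NormedAddCommGroup 𝔤] [NormedSpace ℝ 𝔤] [CompleteSpace 𝔤]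
  [NormedAddCommGroup H] [InnerProductSpace ℂ H] [CompleteSpace H]
  {S : BanachLieSupergroup E G 𝔤} (R : PreRepresentation S H)

/-! ### Continuity of the action -/

/-- Complementary closed subspaces of a Banach space have bounded projections. -/
theorem exists_norm_parts_le (S : BanachLieSuperalgebra 𝔤) :
    ∃ M : ℝ, 0 ≤ M ∧ ∀ x : 𝔤, ‖S.evenPart x‖ ≤ M * ‖x‖ ∧ ‖S.oddPart x‖ ≤ M * ‖x‖ := by
  have h := Submodule.IsCompl.isTopCompl_of_isClosed S.isCompl (S.isClosed_part 0) (S.isClosed_part 1)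
  let P := (S.part 0).projectionOntoL (S.part 1) h
  let Q := (S.part 1).projectionOntoL (S.part 0) h.symm
  refine ⟨max ‖P‖ ‖Q‖, (norm_nonneg P).trans (le_max_left _ _), fun x => ⟨?_, ?_⟩⟩
  · exact (P.le_opNorm x).trans (by gcongr; exact le_max_left _ _)
  · exact (Q.le_opNorm x).trans (by gcongr; exact le_max_right _ _)

theorem exists_smoothNorm_realRep_le (n : ℕ) : ∃ C : ℝ, 0 ≤ C ∧ ∀ (x : 𝔤) (v : R.Hinf),
    R.smoothNorm n (R.realRep x v) ≤
      C * ‖x‖ * ∑ k ∈ Finset.range (n + 2), R.smoothNorm k v := by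
  obtain ⟨M, hM0, hM⟩ := exists_norm_parts_le S.toBanachLieSuperalgebra
  set c : ℝ := 1 / (2 * √2) with hc
  set D : ℝ := ∑ k ∈ Finset.range (n + 2), ((n + 1).choose k : ℝ) with hD
  have hc0 : 0 ≤ c := by positivity
  have hD0 : 0 ≤ D := Finset.sum_nonneg fun k _ => Nat.cast_nonneg _
  -- The even part contributes `M`; the odd part contributes `c * M` times the sum `D` of the
  -- binomial coefficients.
  refine ⟨M + c * M * D, by positivity, fun x v => ?_⟩
  set Qv := ∑ k ∈ Finset.range (n + 2), R.smoothNorm k v with hQ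
  have hle : ∀ k ∈ Finset.range (n + 2), R.smoothNorm k v ≤ Qv := fun k hk =>
    Finset.single_le_sum (f := fun k => R.smoothNorm k v) (fun k _ => R.smoothNorm_nonneg k v) hk
  have hQ0 : 0 ≤ Qv := Finset.sum_nonneg fun k _ => R.smoothNorm_nonneg k v
  have h1 : R.smoothNorm n (R.evenLin (S.evenPart x) v) ≤ M * ‖x‖ * Qv :=
    (R.smoothNorm_evenLin_le n _ v).trans (mul_le_mul (hM x).1 (hle (n + 1) (by simp))
      (R.smoothNorm_nonneg _ v) (by positivity))
  have h2 : ∑ k ∈ Finset.range (n + 2), ((n + 1).choose k : ℝ) * R.smoothNorm k v ≤ D * Qv := by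
    rw [hD, Finset.sum_mul]
    exact Finset.sum_le_sum fun k hk => mul_le_mul_of_nonneg_left (hle k hk) (Nat.cast_nonneg _)
  have h3 : R.smoothNorm n (R.oddLin (S.oddPart x) v) ≤ c * (M * ‖x‖) * (D * Qv) :=
    (R.smoothNorm_oddLin_le n _ v).trans (mul_le_mul
      (mul_le_mul_of_nonneg_left (hM x).2 hc0) h2
      (Finset.sum_nonneg fun k _ => mul_nonneg (Nat.cast_nonneg _) (R.smoothNorm_nonneg k v))
      (by positivity))
  refine (R.smoothNorm_add_le n _ _).trans ((add_le_add h1 h3).trans (le_of_eq ?_))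
  ring

theorem exists_q_smoothRep_le (n : ℕ) : ∃ C : ℝ≥0∞, C ≠ ⊤ ∧ ∀ (z : ℂ ⊗[ℝ] 𝔤) (v : R.Hinf),
    R.π.q S n (R.smoothRep z v) ≤
      C * complexificationNorm z * ∑ k ∈ Finset.range (n + 2), R.π.q S k v := by
  obtain ⟨C, hC0, hC⟩ := R.exists_smoothNorm_realRep_le n
  -- The factor `2` accounts for the real and imaginary parts, each bounded by the norm of `z`.
  refine ⟨2 * ENNReal.ofReal C, ENNReal.mul_ne_top (by simp) ENNReal.ofReal_ne_top, fun z v => ?_⟩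
  set Qv := ∑ k ∈ Finset.range (n + 2), R.smoothNorm k v with hQ
  have hQ0 : 0 ≤ Qv := Finset.sum_nonneg fun k _ => R.smoothNorm_nonneg k v
  have h1 : R.smoothNorm n (R.smoothRep z v) ≤
      C * ‖tensorRe z‖ * Qv + C * ‖tensorIm z‖ * Qv := by
    rw [smoothRep_apply]
    refine (R.smoothNorm_add_le n _ _).trans (add_le_add (hC _ v) ?_)
    refine (R.smoothNorm_smul_le n _ _).trans ?_
    rw [Complex.norm_I, one_mul]
    exact hC _ v
  have h2 : ENNReal.ofReal Qv = ∑ k ∈ Finset.range (n + 2), R.π.q S k v := by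
    rw [hQ, ENNReal.ofReal_sum_of_nonneg fun k _ => R.smoothNorm_nonneg k v]
    simp only [ofReal_smoothNorm]
  have h3 := ENNReal.ofReal_le_ofReal h1
  rw [ofReal_smoothNorm, ENNReal.ofReal_add (by positivity) (by positivity),
    ENNReal.ofReal_mul (by positivity), ENNReal.ofReal_mul hC0,
    ENNReal.ofReal_mul (by positivity), ENNReal.ofReal_mul hC0, ofReal_norm, ofReal_norm, h2] at h3
  refine h3.trans ?_
  rw [← add_mul, ← mul_add]
  refine mul_le_mul' ?_ le_rfl
  calc ENNReal.ofReal C * (‖tensorRe z‖ₑ + ‖tensorIm z‖ₑ)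
      ≤ ENNReal.ofReal C * (complexificationNorm z + complexificationNorm z) := by
        gcongr
        · exact enorm_tensorRe_le z
        · exact enorm_tensorIm_le z
    _ = 2 * ENNReal.ofReal C * complexificationNorm z := by ring

theorem continuous_smoothRep :
    @Continuous _ _
      (@instTopologicalSpaceProd _ _ (complexificationTopology 𝔤) (R.π.smoothTopology S))
      (R.π.smoothTopology S) (fun p : (ℂ ⊗[ℝ] 𝔤) × R.Hinf => R.smoothRep p.1 p.2) := by
  have hq0 : ∀ k, R.π.q S k ((0 : R.Hinf) : H) = 0 := fun k =>
    le_antisymm ((R.q_le_iff k 0 0).2 fun xs _ _ => by simp) bot_le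
  refine continuous_gaugeTopology_of_le (fun _ z => complexificationNorm_ne_top z)
    (fun _ => complexificationNorm_zero) (fun k v => R.q_ne_top k v) hq0 (fun n v w => ?_)
    (LinearMap.toAddMonoidHom'.comp R.smoothRep.toAddMonoidHom) fun n => ?_
  · refine (R.q_le_iff n (v + w) _).2 fun xs hn hxs => ?_
    rw [map_add, Submodule.coe_add]
    exact (enorm_add_le _ _).trans
      (add_le_add ((R.q_le_iff n v _).1 le_rfl xs hn hxs) ((R.q_le_iff n w _).1 le_rfl xs hn hxs))
  · obtain ⟨C, hC, h⟩ := R.exists_q_smoothRep_le n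
    exact ⟨(), Finset.range (n + 2), C, hC, h⟩

end PreRepresentation

theorem mainTheorem8 {E G 𝔤 H : Type*}
    [NormedAddCommGroup E] [NormedSpace ℝ E] [CompleteSpace E]
    [TopologicalSpace G] [ChartedSpace E G] [Group G] [LieGroup 𝓘(ℝ, E) ω G]
    [NormedAddCommGroup 𝔤] [NormedSpace ℝ 𝔤] [CompleteSpace 𝔤]
    [NormedAddCommGroup H] [InnerProductSpace ℂ H] [CompleteSpace H]
    (S : BanachLieSupergroup E G 𝔤) (R : PreRepresentation S H) :
    -- the map `(x, v) ↦ ρ̃(x) v` is defined on `𝔤^ℂ × H^∞`, takes values in `H^∞`, is bilinear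
    ∃ T : (ℂ ⊗[ℝ] 𝔤) →ₗ[ℂ] R.Hinf →ₗ[ℂ] R.Hinf,
      (∀ (x : ℂ ⊗[ℝ] 𝔤) (v : R.Hinf), ((v : H), (T x v : H)) ∈ (R.tilde x).graph) ∧
      -- the superbracket relation
      (∀ (i j : ZMod 2), ∀ x ∈ S.partC i, ∀ y ∈ S.partC j, ∀ v : R.Hinf,
        T (S.bracketC x y) v =
          T x (T y v) - (-1 : ℂ) ^ (i.val * j.val) • T y (T x v)) ∧
      -- continuity
      (@Continuous _ _
        (@instTopologicalSpaceProd _ _ (complexificationTopology 𝔤) (R.π.smoothTopology S))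
        (R.π.smoothTopology S)
        (fun p : (ℂ ⊗[ℝ] 𝔤) × R.Hinf => T p.1 p.2)) ∧
      -- the seminorms are finite on `H^∞` and satisfy the explicit estimates
      (∀ (n : ℕ) (v : R.Hinf), R.π.q S n v ≠ ⊤) ∧
      (∀ (n : ℕ), ∀ y ∈ S.part 1, ∀ v : R.Hinf,
        R.π.q S n (T (1 ⊗ₜ[ℝ] y) v) ≤
          ENNReal.ofReal (1 / (2 * √2) * ‖y‖) *
            ∑ k ∈ Finset.range (n + 2), ((n + 1).choose k : ℝ≥0∞) * R.π.q S k v) := by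
  refine ⟨R.smoothRep, R.smoothRep_mem_graph, fun i j x hx y hy v => R.smoothRep_bracketC i j hx hy v,
    R.continuous_smoothRep, R.q_ne_top, fun n y hy v => ?_⟩
  have h : R.smoothRep (1 ⊗ₜ[ℝ] y) v = R.oddLin ⟨y, hy⟩ v := by
    rw [R.smoothRep_tmul, one_smul]
    exact DFunLike.congr_fun (R.realRep_odd ⟨y, hy⟩) v
  rw [h]
  exact R.q_oddLin_le n ⟨y, hy⟩ v

end
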